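/- Let $n\ge 1$. Consider a dissipative quantum neural network with $n$ input qubits, $n$ output qubits and no hidden layer. Each output qubit $j=1,\dots,n$ has a global perceptron, a unitary $V_j$ on the $n$ input qubits together with output qubit $j$ ($n+1$ qubits, extended by the identity to the other output qubits). On an input state $\rho$ the network outputs $$\rho^{\mathrm{out}}=\mathrm{Tr}_{\mathrm{in}}\big[V(\rho\otimes|0\cdots0\rangle\langle 0\cdots 0|)V^\dagger\big],\qquad V=V_n\cdots V_2V_1 .$$ Let $|\phi_x^{\mathrm{in}}\rangle$, $|\phi_x^{\mathrm{out}}\rangle$, $x=1,\dots,N$ ($N\ge1$), be normalized $n$-qubit states (training data), and let $C=\frac1N\sum_{x=1}^N\mathrm{Tr}[O_x\rho_x^{\mathrm{out}}]$, where $\rho_x^{\mathrm{out}}$ is the output for the input $|\phi_x^{\mathrm{in}}\rangle\langle\phi_x^{\mathrm{in}}|$, and where $O_x$ is, for all $x$, either the global operator $$O_x^G=\mathbb 1-|\phi_x^{\mathrm{out}}\rangle\langle\phi_x^{\mathrm{out}}|,$$ or, when $|\phi_x^{\mathrm{out}}\rangle=|\psi_{x,1}\rangle\otimes\cdots\otimes|\psi_{x,n}\rangle$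 is a product of normalized one-qubit states, the local operator $$O_x^L=\mathbb 1-\frac1n\sum_{j=1}^n|\psi_{x,j}\rangle\langle\psi_{x,j}|\otimes\mathbb 1_{\overline j}$$ ($\mathbb 1_{\overline j}$ is the identity on the output qubits other than $j$). All perceptrons are updated simultaneously by $V_j(\varepsilon)=e^{i\varepsilon H_j}V_j(0)$, where the $H_j$ are Hermitian operators on $n+1$ qubits with $\mathrm{Tr}[H_j^2]\le 2^{n+1}$ that do not depend on the random initialization, and $\partial_sC=\lim_{\varepsilon\to0}\frac{C(\varepsilon)-C(0)}{\varepsilon}$ is the derivative of the cost at the initial time $s=0$. A finite family $\{V_y\}_{y\in Y}$ in the unitary group $U(d)$ is a $2$-design if $\frac1{|Y|}\sum_{y\in Y}P(V_y)=\int_{U(d)}P\,d\mu$ ($\mu$ the Haar probability measure) for every polynomial $P$ of degree at most $2$ in the matrix elements of $V$ and at most $2$ in those of $V^\dagger$. Suppose that the $V_j(0)$, $j=1,\dots,n$, are drawn independently, each uniformly from a $2$-design on $n+1$ qubits ($d=2^{n+1}$). Then there is a function $f$ of $n$ alone (independent of $N$, the training data, the designs and the $H_j$) with $f(n)\in\mathcal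 O(1/2^n)$ such that, both for the global operators $O_x^G$ and for the local operators $O_x^L$, the derivative $\partial_sC$ exists for every draw and $$\mathrm{Var}[\partial_sC]=\langle(\partial_sC)^2\rangle-\langle\partial_sC\rangle^2\le f(n).$$ -/

import Mathlib

open Matrix
open scoped Kronecker

namespace DQNN

noncomputable section

/-! ### Unitary designs -/

section Design

variable (ι : Type) [Fintype ι] [DecidableEq ι]

/-- The Borel `σ`-algebra of the unitary group. -/
instance instMeasurableSpaceUnitaryGroup : MeasurableSpace (unitaryGroup ι ℂ) := borel _

instance instBorelSpaceUnitaryGroup : BorelSpace (unitaryGroup ι ℂ) := ⟨rfl⟩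

theorem isCompact_unitaryGroup : IsCompact (unitaryGroup ι ℂ : Set (Matrix ι ι ℂ)) := by
  have hc : IsCompact (Set.univ.pi fun _ : ι => Set.univ.pi fun _ : ι =>
      Metric.closedBall (0 : ℂ) 1) :=
    isCompact_univ_pi fun _ => isCompact_univ_pi fun _ => isCompact_closedBall _ _
  have hcl : IsClosed (unitaryGroup ι ℂ : Set (Matrix ι ι ℂ)) := isClosed_unitary
  refine IsCompact.of_isClosed_subset hc hcl ?_
  intro U hU i _ j _
  simpa using entry_norm_bound_of_unitary hU i j

instance instCompactSpaceUnitaryGroup : CompactSpace (unitaryGroup ι ℂ) :=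
  isCompact_iff_compactSpace.mp (isCompact_unitaryGroup ι)

/-- The Haar probability measure on the unitary group. -/
def haarUnitary : MeasureTheory.Measure (unitaryGroup ι ℂ) :=
  MeasureTheory.Measure.haarMeasure ⊤

variable {ι}

/-- Polynomials in the matrix elements of `V` (the variables `Sum.inl (i, k)`) and of `V†`
(the variables `Sum.inr (i, k)`). -/
abbrev EntryPoly (ι : Type) : Type := MvPolynomial ((ι × ι) ⊕ (ι × ι)) ℂ

/-- Degree at most `t` in the matrix elements of `V`, and at most `t` in those of `V†`. -/
def EntryPoly.HasBidegreeLE (P : EntryPoly ι) (t : ℕ) : Prop :=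
  ∀ m ∈ P.support, (∑ p, m (Sum.inl p)) ≤ t ∧ (∑ p, m (Sum.inr p)) ≤ t

/-- The value `P(V)`. -/
def EntryPoly.value (P : EntryPoly ι) (V : unitaryGroup ι ℂ) : ℂ :=
  MvPolynomial.eval
    (Sum.elim (fun p => (V : Matrix ι ι ℂ) p.1 p.2) (fun p => (V : Matrix ι ι ℂ)ᴴ p.1 p.2)) P

/-- A finite family `(V_y)_{y ∈ Y}` of unitaries is a unitary `t`-design. -/
def IsUnitaryDesign (t : ℕ) {Y : Type} [Fintype Y] (V : Y → unitaryGroup ι ℂ) : Prop :=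
  ∀ P : EntryPoly ι, P.HasBidegreeLE t →
    (1 / (Fintype.card Y : ℂ)) * ∑ y, P.value (V y) = ∫ U, P.value U ∂(haarUnitary ι)

end Design

/-! ### The network: `n` input qubits, `n` output qubits, no hidden layer -/

/-- Labels of the computational basis of `n` qubits. -/
abbrev Bits (n : ℕ) : Type := Fin n → Fin 2

/-- Labels of the computational basis of the space that a global perceptron acts on: all
`n` input qubits and one output qubit. -/
abbrev PBits (n : ℕ) : Type := Bits n × Fin 2

/-- Labels of the computational basis of the whole network: input qubits, output qubits. -/
abbrev NBits (n : ℕ) : Type := Bits n × Bits n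

variable {n : ℕ}

/-- `ψ` is a normalized vector. -/
def IsState {ι : Type} [Fintype ι] (ψ : ι → ℂ) : Prop := ∑ i, ‖ψ i‖ ^ 2 = 1

/-- `|ψ⟩⟨ψ|`. -/
def proj {ι : Type} (ψ : ι → ℂ) : Matrix ι ι ℂ := vecMulVec ψ (star ψ)

/-- The basis vector `|0…0⟩`. -/
def zeroState (n : ℕ) : Bits n → ℂ := Pi.single 0 1

/-- The operator on the network that acts as `W` on the input qubits together with output
qubit `j`, and as the identity on the other output qubits. -/
def onInputAnd (j : Fin n) (W : Matrix (PBits n) (PBits n) ℂ) :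
    Matrix (NBits n) (NBits n) ℂ :=
  of fun p q => if ∀ k, k ≠ j → p.2 k = q.2 k then W (p.1, p.2 j) (q.1, q.2 j) else 0

/-- The operator on the output layer that acts as `W` on qubit `j`, and as the identity on the
other qubits. -/
def onOutput (j : Fin n) (W : Matrix (Fin 2) (Fin 2) ℂ) : Matrix (Bits n) (Bits n) ℂ :=
  of fun b c => if ∀ k, k ≠ j → b k = c k then W (b j) (c j) else 0

/-- The network operator `V_n ⋯ V_2 V_1`: the perceptron of the first output qubit acts first. -/
def network (V : Fin n → Matrix (PBits n) (PBits n) ℂ) : Matrix (NBits n) (NBits n) ℂ :=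
  (List.ofFn fun j => onInputAnd j (V j)).reverse.prod

/-- The partial trace over the input layer. -/
def traceIn (M : Matrix (NBits n) (NBits n) ℂ) : Matrix (Bits n) (Bits n) ℂ :=
  of fun b c => ∑ a, M (a, b) (a, c)

/-- The output state `Tr_in [V (ρ ⊗ |0…0⟩⟨0…0|) V†]`. -/
def outState (V : Fin n → Matrix (PBits n) (PBits n) ℂ) (ρ : Matrix (Bits n) (Bits n) ℂ) :
    Matrix (Bits n) (Bits n) ℂ :=
  traceIn (network V * (ρ ⊗ₖ proj (zeroState n)) * (network V)ᴴ)

/-- The cost `(1/N) ∑_x Tr [O_x ρ_x^out]` for the pure input states `φ_x`. (The traces are real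
whenever the `O_x` are Hermitian.) -/
def cost {N : ℕ} (φ : Fin N → Bits n → ℂ) (O : Fin N → Matrix (Bits n) (Bits n) ℂ)
    (V : Fin n → Matrix (PBits n) (PBits n) ℂ) : ℝ :=
  (1 / (N : ℝ)) * ∑ x, (O x * outState V (proj (φ x))).trace.re

/-- The global operator `1 - |φ⟩⟨φ|`. -/
def globalOp (φ : Bits n → ℂ) : Matrix (Bits n) (Bits n) ℂ := 1 - proj φ

/-- The local operator `1 - (1/n) ∑_j |ψ_j⟩⟨ψ_j| ⊗ 1` for the product state
`ψ_1 ⊗ ⋯ ⊗ ψ_n`. -/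
def localOp (ψ : Fin n → Fin 2 → ℂ) : Matrix (Bits n) (Bits n) ℂ :=
  1 - (1 / (n : ℂ)) • ∑ j, onOutput j (proj (ψ j))

/-! ### Parameter matrix multiplication -/

/-- All perceptrons after a time step `ε`: `V_j(ε) = e^{iεH_j} V_j(0)`. -/
def update (H V : Fin n → Matrix (PBits n) (PBits n) ℂ) (ε : ℝ) :
    Fin n → Matrix (PBits n) (PBits n) ℂ :=
  fun j => NormedSpace.exp ((Complex.I * (ε : ℂ)) • H j) * V j

/-- The cost as a function of the time-step parameter, starting from the perceptrons `V`. -/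
def costAlong {N : ℕ} (φ : Fin N → Bits n → ℂ) (O : Fin N → Matrix (Bits n) (Bits n) ℂ)
    (H : Fin n → Matrix (PBits n) (PBits n) ℂ) (V : Fin n → unitaryGroup (PBits n) ℂ)
    (s : ℝ) : ℝ :=
  cost φ O (update H (fun j => (V j : Matrix (PBits n) (PBits n) ℂ)) s)

/-- The derivative `∂_s C` at the initial time `s = 0`. -/
def dCost {N : ℕ} (φ : Fin N → Bits n → ℂ) (O : Fin N → Matrix (Bits n) (Bits n) ℂ)
    (H : Fin n → Matrix (PBits n) (PBits n) ℂ) (V : Fin n → unitaryGroup (PBits n) ℂ) : ℝ :=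
  deriv (costAlong φ O H V) 0

/-! ### Averages over independently initialized perceptrons -/

section Average

variable {Y : Fin n → Type} [∀ j, Fintype (Y j)]

/-- The average of `F` when the indices `y_j ∈ Y_j` are drawn uniformly and independently. -/
def average (F : (∀ j, Y j) → ℝ) : ℝ :=
  (1 / (Fintype.card (∀ j, Y j) : ℝ)) * ∑ y, F y

/-- The variance `⟨F²⟩ - ⟨F⟩²`. -/
def variance (F : (∀ j, Y j) → ℝ) : ℝ :=
  average (fun y => F y ^ 2) - average F ^ 2

end Average

end

end DQNN

/-!
The derivative of the cost is a sum over the perceptrons `k` of *forces* `force k (H k) M_k ψ_k`: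
here `ψ_k` is the state of the network just after the perceptron `k` has acted (`stateAfter`), and
`M_k` is the observable `1 ⊗ O`, pulled back through the later perceptrons (`heis`). Since an output
qubit is in the state `|0⟩` until its perceptron acts, pulling back through the perceptron `l` means
conjugation with it, followed by the expectation value in the state `|0⟩` of its output qubit
(`pull`); see `hasDerivAt_expectation_stateAfter`.

*One perceptron.* The force on `k` is a quadratic form in the entries of `V k` and their conjugates,
so its mean square over a `2`-design is determined by the second moments of the Haar measure. These
follow from invariance: a tensor with four indices that is invariant under `U ⊗ U` is a combination
of the identity and the swap (`IsTwirlInvariant.exists_eq`). The result is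
`IsUnitaryDesign.expect_force_sq_le`: the mean square is at most `4 / (d² - 1)` times the squared
Frobenius norm of `W (M_k - c)`, where `d = 2 ^ (n + 1)`, the matrix `W` (`leverage`) has squared
Frobenius norm `Tr (H k)² ≤ d`, and `c` is any real number. For an observable with `0 ≤ M_k ≤ 1`
this is of order `1 / 2 ^ n` already. A sum of up to `n` such forces stays of this order because the mean
squares decay geometrically in the number of perceptrons between `k` and the last relevant one.

*Global cost.* Up to a sign, the forces for `1 - P` are those for the projector `P = |χ⟩⟨χ|`. For
these, `0 ≤ M_k ≤ 1` bounds the squared Frobenius norm of `W M_k` by `Tr (W M_k W†)`, which is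
linear in `M_k`. On average, pulling back through a perceptron depolarizes its output qubit
(`expect_trace_mul_heis`), and in the state `|0⟩` of the later output qubits each depolarization
yields a factor `1 / 2` (`trace_mul_depolarizeFrom_le`).

*Local cost.* For an observable of the output qubit `j`, the perceptrons after `j` do not matter.
Before the perceptron `j` acts, the pulled back observable lives on the input layer alone, and every
further step back halves its mean squared Frobenius distance from the scalars
(`IsUnitaryDesign.expect_spread_compress_le`). With the normalized trace as the number `c` above,
these halvings carry over to the mean square forces.

In both cases the Cauchy-Schwarz inequality with geometric weights (`expect_sum_sq_le`) bounds the
mean square of the sum of the forces by a constant times `d / (d² - 1)`. Averages over the training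
data and, for the local cost, over `j` are handled by the convexity of the square.
-/

open Matrix
open scoped Kronecker

namespace DQNN

/-! ### Second moments of the Haar measure and of unitary `2`-designs -/

section Commutant

variable {ι : Type} [DecidableEq ι]

/-- The Householder reflection along the real vector `e_a + 2 e_b`: an orthogonal matrix with
rational entries that mixes two basis vectors. -/
noncomputable def householder (a b : ι) : Matrix ι ι ℂ :=
  of fun i j => (if i = j then 1 else 0)
    - 2 / 5 * ((Pi.single a 1 + Pi.single b 2 : ι → ℂ) i
      * (Pi.single a 1 + Pi.single b 2 : ι → ℂ) j)

theorem householder_apply_left {a b : ι} (h : a ≠ b) (j : ι) :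
    householder a b a j
      = 3 / 5 * (if j = a then 1 else 0) + (-4 / 5) * (if j = b then 1 else 0) := by
  by_cases h1 : j = a
  · subst h1; simp [householder, h]; norm_num
  · by_cases h2 : j = b
    · subst h2; simp [householder, h, h.symm]; norm_num
    · simp [householder, h, h1, h2, Ne.symm h1]

variable [Fintype ι]

/-- The invariance under `U ⊗ U` of a tensor with four indices, two of which transform with the
complex conjugate matrix. -/
def IsTwirlInvariant (Θ : ι → ι → ι → ι → ℂ) : Prop :=
  ∀ U ∈ unitaryGroup ι ℂ, ∀ a b c e, Θ a b c e =
    ∑ a', ∑ b', ∑ c', ∑ e',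
      star (U a a') * U b b' * star (U c c') * U e e' * Θ a' b' c' e'

theorem diagonal_mem_unitaryGroup (t : ι → ℂ) (ht : ∀ i, star (t i) * t i = 1) :
    diagonal t ∈ unitaryGroup ι ℂ := by
  rw [mem_unitaryGroup_iff']
  ext i j
  by_cases h : i = j
  · subst h; simp [star_eq_conjTranspose, ← ht i]
  · simp [star_eq_conjTranspose, h]

theorem permMatrix_mem_unitaryGroup (σ : Equiv.Perm ι) :
    (of fun i j => if σ i = j then (1 : ℂ) else 0) ∈ unitaryGroup ι ℂ := by
  rw [mem_unitaryGroup_iff]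
  ext i j
  simp [star_eq_conjTranspose, mul_apply, one_apply]

theorem householder_mem_unitaryGroup {a b : ι} (h : a ≠ b) :
    householder a b ∈ unitaryGroup ι ℂ := by
  rw [mem_unitaryGroup_iff]
  have hx : (Pi.single a 1 + Pi.single b 2 : ι → ℂ) ⬝ᵥ (Pi.single a 1 + Pi.single b 2) = 5 := by
    simp [dotProduct_add, h, h.symm]; norm_num
  have hs : star (Pi.single a 1 + Pi.single b 2 : ι → ℂ) = Pi.single a 1 + Pi.single b 2 := by
    ext i
    simp only [Pi.star_apply, Pi.add_apply, Pi.single_apply]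
    split_ifs <;> simp
  have hr : householder a b = 1 - (2 / 5 : ℂ) • vecMulVec (Pi.single a 1 + Pi.single b 2)
      (Pi.single a 1 + Pi.single b 2) := by
    ext i j; simp [householder, one_apply, vecMulVec_apply]
  have hst : star (householder a b) = householder a b := by
    rw [hr, star_eq_conjTranspose, conjTranspose_sub, conjTranspose_smul, conjTranspose_vecMulVec,
      hs]
    simp
  rw [hst, hr, sub_mul, mul_sub, mul_sub]
  simp only [one_mul, mul_one, smul_mul_assoc, mul_smul_comm, vecMulVec_mul_vecMulVec, hx,
    vecMulVec_smul]
  ext i j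
  simp only [Matrix.sub_apply, Matrix.smul_apply, smul_eq_mul]
  ring

/-- Diagonal unitaries kill all entries in which the index pairs `(a, c)` and `(b, e)` differ
as multisets. -/
theorem IsTwirlInvariant.eq_zero {Θ : ι → ι → ι → ι → ℂ} (hΘ : IsTwirlInvariant Θ)
    {a b c e : ι} (h1 : ¬ (a = b ∧ c = e)) (h2 : ¬ (b = c ∧ a = e)) : Θ a b c e = 0 := by
  have key : ∀ t : ι → ℂ, (∀ i, star (t i) * t i = 1) →
      Θ a b c e = star (t a) * t b * star (t c) * t e * Θ a b c e := by
    intro t ht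
    have := hΘ _ (diagonal_mem_unitaryGroup t ht) a b c e
    simpa [diagonal_apply, apply_ite (starRingEnd ℂ)] using this
  have ht : ∀ m : ι, ∀ i, star (if i = m then Complex.I else 1) * (if i = m then Complex.I else 1)
      = (1 : ℂ) := by
    intro m i; split_ifs <;> simp
  have main : ∀ m : ι, Θ a b c e ≠ 0 →
      star (if a = m then Complex.I else (1 : ℂ)) * (if b = m then Complex.I else 1)
        * star (if c = m then Complex.I else 1) * (if e = m then Complex.I else 1) = 1 := by
    intro m h0
    have := key _ (ht m)
    exact mul_right_cancel₀ h0 (by rw [← this, one_mul])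
  by_contra h0
  have hI1 : Complex.I ≠ 1 := fun h => by simpa using congrArg Complex.re h
  have hI2 : -Complex.I ≠ 1 := fun h => by simpa using congrArg Complex.re h
  by_cases hab : a = b
  · subst hab
    have hce : ¬ e = c := fun h => h1 ⟨rfl, h.symm⟩
    have := main c h0
    by_cases hac : a = c <;> simp [hac, hce, hI2] at this
  · have ma := main a h0
    have hea : e = a := by
      by_contra hea
      by_cases hca : c = a
      · norm_num [hca, hea, Ne.symm hab] at ma
      · simp [hca, hea, Ne.symm hab, hI2] at ma
    have hcb : ¬ c = b := fun h => h2 ⟨h.symm, hea.symm⟩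
    have := main b h0
    simp [hea, hab, hcb, hI1] at this

/-- The tensors invariant under `U ⊗ U` are spanned by the identity and the swap. -/
theorem IsTwirlInvariant.exists_eq [Nontrivial ι] {Θ : ι → ι → ι → ι → ℂ}
    (hΘ : IsTwirlInvariant Θ) :
    ∃ α β : ℂ, ∀ a b c e, Θ a b c e =
      α * ((if a = b then 1 else 0) * (if c = e then 1 else 0))
        + β * ((if b = c then 1 else 0) * (if a = e then 1 else 0)) := by
  obtain ⟨p, q, hpq⟩ := exists_pair_ne ι
  have perm : ∀ σ : Equiv.Perm ι, ∀ a b c e, Θ a b c e = Θ (σ a) (σ b) (σ c) (σ e) := by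
    intro σ a b c e
    have := hΘ _ (permMatrix_mem_unitaryGroup σ) a b c e
    simpa [apply_ite] using this
  -- the group of permutations is transitive on ordered pairs of distinct indices
  have trans : ∀ a c : ι, a ≠ c → ∃ σ : Equiv.Perm ι, σ a = p ∧ σ c = q := by
    intro a c hac
    have h1 : Equiv.swap a p c ≠ p := fun h => hac <| by
      have := congrArg (Equiv.swap a p) h
      simpa using this.symm
    refine ⟨Equiv.swap (Equiv.swap a p c) q * Equiv.swap a p, ?_, by simp⟩
    simp [Equiv.swap_apply_of_ne_of_ne h1.symm hpq]
  have one : ∀ a : ι, Θ a a a a = Θ p p p p := by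
    intro a; simpa using perm (Equiv.swap a p) a a a a
  -- the one relation that permutations and diagonal unitaries do not give
  have hh : Θ p p p p = Θ p p q q + Θ p q q p := by
    have h := hΘ _ (householder_mem_unitaryGroup hpq) p p p p
    simp only [householder_apply_left hpq] at h
    simp only [star_add, add_mul, mul_add, Finset.sum_add_distrib, apply_ite star,
      star_zero, mul_ite, ite_mul, mul_zero, mul_one, zero_mul, Finset.sum_ite_eq',
      Finset.mem_univ, if_true] at h
    have e1 : Θ q q p p = Θ p p q q := by simpa using perm (Equiv.swap p q) q q p p
    have e2 : Θ q p p q = Θ p q q p := by simpa using perm (Equiv.swap p q) q p p q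
    have z1 : Θ p p p q = 0 := hΘ.eq_zero (by simp [hpq]) (by simp [hpq])
    have z2 : Θ p p q p = 0 := hΘ.eq_zero (by simp [hpq.symm]) (by simp [hpq])
    have z3 : Θ p q p p = 0 := hΘ.eq_zero (by simp [hpq]) (by simp [hpq.symm])
    have z4 : Θ q p p p = 0 := hΘ.eq_zero (by simp [hpq.symm]) (by simp [hpq.symm])
    have z5 : Θ q q q p = 0 := hΘ.eq_zero (by simp [hpq.symm]) (by simp [hpq.symm])
    have z6 : Θ q q p q = 0 := hΘ.eq_zero (by simp [hpq]) (by simp [hpq.symm])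
    have z7 : Θ q p q q = 0 := hΘ.eq_zero (by simp [hpq.symm]) (by simp [hpq])
    have z8 : Θ p q q q = 0 := hΘ.eq_zero (by simp [hpq]) (by simp [hpq])
    have z9 : Θ p q p q = 0 := hΘ.eq_zero (by simp [hpq]) (by simp [hpq.symm])
    have z10 : Θ q p q p = 0 := hΘ.eq_zero (by simp [hpq.symm]) (by simp [hpq])
    have e3 := one q
    simp only [e1, e2, e3, z1, z2, z3, z4, z5, z6, z7, z8, z9, z10] at h
    norm_num at h
    linear_combination (625 / 288) * h
  refine ⟨Θ p p q q, Θ p q q p, fun a b c e => ?_⟩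
  by_cases h1 : a = b ∧ c = e
  · obtain ⟨rfl, rfl⟩ := h1
    by_cases hac : a = c
    · subst hac; simp [one, hh]
    · obtain ⟨σ, rfl, rfl⟩ := trans a c hac
      simpa [hac] using perm σ a a c c
  · by_cases h2 : b = c ∧ a = e
    · obtain ⟨rfl, rfl⟩ := h2
      have hab : a ≠ b := fun h => h1 ⟨h, h.symm⟩
      obtain ⟨σ, rfl, rfl⟩ := trans a b hab
      simpa [hab] using perm σ a b b a
    · rw [hΘ.eq_zero h1 h2]
      rw [not_and_or] at h1 h2
      rcases h1 with h1 | h1 <;> rcases h2 with h2 | h2 <;> simp [h1, h2]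

end Commutant

section Moments

open MeasureTheory
open scoped BigOperators

variable {ι : Type} [Fintype ι]

/-- The product of four matrix entries whose averages are the second moments. -/
noncomputable def quad (i j k l : ι) (V : Matrix ι ι ℂ) (a b c e : ι) : ℂ :=
  star (V a i) * V b j * star (V c k) * V e l

theorem quad_mul (i j k l : ι) (U V : Matrix ι ι ℂ) (a b c e : ι) :
    quad i j k l (U * V) a b c e = ∑ x : ι × ι × ι × ι,
      star (U a x.1) * U b x.2.1 * star (U c x.2.2.1) * U e x.2.2.2
        * quad i j k l V x.1 x.2.1 x.2.2.1 x.2.2.2 := by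
  have h : ∀ x : ι × ι × ι × ι, star (U a x.1) * U b x.2.1 * star (U c x.2.2.1) * U e x.2.2.2
        * quad i j k l V x.1 x.2.1 x.2.2.1 x.2.2.2
      = star (U a x.1 * V x.1 i) * ((U b x.2.1 * V x.2.1 j)
        * (star (U c x.2.2.1 * V x.2.2.1 k) * (U e x.2.2.2 * V x.2.2.2 l))) := by
    intro x; simp only [quad, star_mul']; ring
  simp_rw [h, Fintype.sum_prod_type, ← Finset.mul_sum, ← Finset.sum_mul, ← star_sum]
  simp only [quad, mul_apply]
  ring

variable [DecidableEq ι]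

instance : (haarUnitary ι).IsMulLeftInvariant :=
  inferInstanceAs (Measure.haarMeasure ⊤).IsMulLeftInvariant

instance : IsProbabilityMeasure (haarUnitary ι) :=
  ⟨Measure.haarMeasure_self (K₀ := (⊤ : TopologicalSpace.PositiveCompacts (unitaryGroup ι ℂ)))⟩

theorem continuous_unitaryGroup_entry (a i : ι) :
    Continuous fun V : unitaryGroup ι ℂ => (V : Matrix ι ι ℂ) a i :=
  (continuous_apply_apply a i).comp continuous_subtype_val

theorem integrable_haarUnitary {f : unitaryGroup ι ℂ → ℂ} (hf : Continuous f) :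
    Integrable f (haarUnitary ι) :=
  hf.integrable_of_hasCompactSupport (HasCompactSupport.of_compactSpace f)

theorem continuous_quad (i j k l a b c e : ι) :
    Continuous fun V : unitaryGroup ι ℂ => quad i j k l (V : Matrix ι ι ℂ) a b c e := by
  unfold quad
  have h := continuous_unitaryGroup_entry (ι := ι)
  exact (((h a i).star.mul (h b j)).mul (h c k).star).mul (h e l)

theorem isTwirlInvariant_integral_quad (i j k l : ι) :
    IsTwirlInvariant fun a b c e => ∫ V, quad i j k l V a b c e ∂(haarUnitary ι) := by
  intro U hU a b c e
  have h : ∫ V, quad i j k l V a b c e ∂(haarUnitary ι)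
      = ∫ V, quad i j k l (U * (V : Matrix ι ι ℂ)) a b c e ∂(haarUnitary ι) :=
    (integral_mul_left_eq_self (μ := haarUnitary ι)
      (fun V : unitaryGroup ι ℂ => quad i j k l V a b c e) ⟨U, hU⟩).symm
  simp only [h, quad_mul]
  rw [integral_finsetSum _ fun x _ => (integrable_haarUnitary (continuous_quad ..)).const_mul _]
  simp_rw [integral_const_mul, Fintype.sum_prod_type]

theorem sum_star_mul_of_unitary (V : unitaryGroup ι ℂ) (i j : ι) :
    ∑ a, star ((V : Matrix ι ι ℂ) a i) * (V : Matrix ι ι ℂ) a j = if i = j then 1 else 0 := by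
  have h := congrFun (congrFun (mem_unitaryGroup_iff'.mp V.2) i) j
  simpa [mul_apply, star_eq_conjTranspose, one_apply] using h

/-- The average of `conj V_{ai} V_{bj} conj V_{ck} V_{el}` over the unitary group of a
`d`-dimensional space. -/
noncomputable def secondMoment (i j k l a b c e : ι) : ℂ :=
  (((if a = b then 1 else 0) * (if c = e then 1 else 0)
      - (if b = c then 1 else 0) * (if a = e then 1 else 0) / Fintype.card ι)
        * ((if i = j then 1 else 0) * (if k = l then 1 else 0))
    + ((if b = c then 1 else 0) * (if a = e then 1 else 0)
      - (if a = b then 1 else 0) * (if c = e then 1 else 0) / Fintype.card ι)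
        * ((if i = l then 1 else 0) * (if j = k then 1 else 0)))
    / ((Fintype.card ι : ℂ) ^ 2 - 1)

theorem integral_quad [Nontrivial ι] (i j k l a b c e : ι) :
    ∫ V, quad i j k l V a b c e ∂(haarUnitary ι) = secondMoment i j k l a b c e := by
  obtain ⟨α, β, h⟩ := (isTwirlInvariant_integral_quad i j k l).exists_eq
  have hint : ∀ a b c e : ι, Integrable
      (fun V : unitaryGroup ι ℂ => quad i j k l (V : Matrix ι ι ℂ) a b c e) (haarUnitary ι) :=
    fun a b c e => integrable_haarUnitary (continuous_quad i j k l a b c e)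
  -- the two contractions that unitarity evaluates determine `α` and `β`
  have h1 : ∑ x : ι × ι, ∫ V, quad i j k l V x.1 x.1 x.2 x.2 ∂(haarUnitary ι)
      = (if i = j then 1 else 0) * (if k = l then 1 else 0) := by
    rw [← integral_finsetSum _ fun x _ => hint _ _ _ _]
    have : ∀ V : unitaryGroup ι ℂ, ∑ x : ι × ι, quad i j k l (V : Matrix ι ι ℂ) x.1 x.1 x.2 x.2
        = (if i = j then 1 else 0) * (if k = l then 1 else 0) := by
      intro V
      rw [← sum_star_mul_of_unitary V, ← sum_star_mul_of_unitary V, Finset.sum_mul_sum,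
        Fintype.sum_prod_type]
      simp only [quad, mul_assoc]
    simp only [this, integral_const, probReal_univ, one_smul]
  have h2 : ∑ x : ι × ι, ∫ V, quad i j k l V x.1 x.2 x.2 x.1 ∂(haarUnitary ι)
      = (if i = l then 1 else 0) * (if j = k then 1 else 0) := by
    rw [← integral_finsetSum _ fun x _ => hint _ _ _ _]
    have : ∀ V : unitaryGroup ι ℂ, ∑ x : ι × ι, quad i j k l (V : Matrix ι ι ℂ) x.1 x.2 x.2 x.1
        = (if i = l then 1 else 0) * (if j = k then 1 else 0) := by
      intro V
      simp only [eq_comm (a := j)]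
      rw [← sum_star_mul_of_unitary V, ← sum_star_mul_of_unitary V, Finset.sum_mul_sum,
        Fintype.sum_prod_type]
      refine Finset.sum_congr rfl fun x _ => Finset.sum_congr rfl fun y _ => ?_
      simp only [quad]
      ring
    simp only [this, integral_const, probReal_univ, one_smul]
  rw [h, secondMoment]
  generalize ((if i = j then (1 : ℂ) else 0) * (if k = l then 1 else 0)) = s at h1 ⊢
  generalize ((if i = l then (1 : ℂ) else 0) * (if j = k then 1 else 0)) = t at h2 ⊢
  generalize ((if a = b then (1 : ℂ) else 0) * (if c = e then 1 else 0)) = x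
  generalize ((if b = c then (1 : ℂ) else 0) * (if a = e then 1 else 0)) = y
  have hd : (1 : ℝ) < Fintype.card ι := by exact_mod_cast Fintype.one_lt_card
  have hd0 : (Fintype.card ι : ℂ) ≠ 0 := by
    exact_mod_cast (by positivity : (Fintype.card ι : ℝ) ≠ 0)
  have hd1 : (Fintype.card ι : ℂ) ^ 2 - 1 ≠ 0 := by
    exact_mod_cast (by nlinarith : (Fintype.card ι : ℝ) ^ 2 - 1 ≠ 0)
  have h1' : s = α * (Fintype.card ι : ℂ) ^ 2 + β * Fintype.card ι := by
    rw [← h1]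
    simp [h, Fintype.sum_prod_type, Finset.sum_add_distrib]
    ring
  have h2' : t = α * Fintype.card ι + β * (Fintype.card ι : ℂ) ^ 2 := by
    rw [← h2]
    simp [h, Fintype.sum_prod_type, Finset.sum_add_distrib, eq_comm]
    ring
  rw [eq_div_iff hd1, h1', h2']
  field_simp
  ring

/-- The average of `conj V_{ai} V_{bj} conj V_{ck} V_{el}` over a unitary `2`-design. -/
theorem IsUnitaryDesign.expect_quad [Nontrivial ι] {Y : Type} [Fintype Y]
    {V : Y → unitaryGroup ι ℂ} (hV : IsUnitaryDesign 2 V) (i j k l a b c e : ι) :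
    𝔼 y, quad i j k l (V y : Matrix ι ι ℂ) a b c e = secondMoment i j k l a b c e := by
  let m : (ι × ι) ⊕ (ι × ι) →₀ ℕ := Finsupp.single (Sum.inr (i, a)) 1
    + Finsupp.single (Sum.inl (b, j)) 1 + Finsupp.single (Sum.inr (k, c)) 1
    + Finsupp.single (Sum.inl (e, l)) 1
  have hP : EntryPoly.HasBidegreeLE (MvPolynomial.monomial m 1) 2 := by
    intro m' hm'
    have : m' = m := by simpa using MvPolynomial.support_monomial_subset hm'
    subst this
    simp [m, Finset.sum_add_distrib, Finsupp.single_apply]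
  have hval : ∀ U : unitaryGroup ι ℂ, EntryPoly.value (MvPolynomial.monomial m 1) U
      = quad i j k l (U : Matrix ι ι ℂ) a b c e := by
    intro U
    simp [EntryPoly.value, m, MvPolynomial.eval_monomial, Finsupp.prod_add_index', pow_add, quad]
  have h := hV _ hP
  simp only [hval, integral_quad] at h
  rw [← h, Fintype.expect_eq_sum_div_card]
  ring

theorem IsUnitaryDesign.nonempty {t : ℕ} {Y : Type} [Fintype Y]
    {V : Y → unitaryGroup ι ℂ} (hV : IsUnitaryDesign t V) : Nonempty Y := by
  by_contra hY
  rw [not_nonempty_iff] at hY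
  have h := hV 1 (by
    intro m hm
    have : m = 0 := by
      simpa using MvPolynomial.support_monomial_subset (s := 0) (a := (1 : ℂ)) hm
    simp [this])
  simp [EntryPoly.value, probReal_univ] at h

end Moments

section Twirl

open scoped BigOperators

variable {ι : Type} [Fintype ι]

theorem conj_apply_mul_conj_apply (V A B : Matrix ι ι ℂ) (i j k l : ι) :
    (Vᴴ * A * V) i j * (Vᴴ * B * V) k l =
      ∑ x : ι × ι × ι × ι, A x.1 x.2.1 * B x.2.2.1 x.2.2.2
        * quad i j k l V x.1 x.2.1 x.2.2.1 x.2.2.2 := by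
  have h : ∀ (C : Matrix ι ι ℂ) i j, (Vᴴ * C * V) i j
      = ∑ x : ι × ι, star (V x.1 i) * C x.1 x.2 * V x.2 j := by
    intro C i j
    simp only [mul_apply, conjTranspose_apply, Finset.sum_mul, Fintype.sum_prod_type]
    exact Finset.sum_comm
  rw [h, h, Finset.sum_mul_sum, ← Fintype.sum_prod_type',
    ← (Equiv.prodAssoc ι ι (ι × ι)).symm.sum_comp]
  refine Fintype.sum_congr _ _ fun x => ?_
  simp only [quad, Equiv.prodAssoc_symm_apply]
  ring

variable [DecidableEq ι]

/-- The average of `V† A V ⊗ V† B V` over a unitary `2`-design. -/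
theorem IsUnitaryDesign.expect_conj_mul_conj [Nontrivial ι] {Y : Type} [Fintype Y]
    {V : Y → unitaryGroup ι ℂ} (hV : IsUnitaryDesign 2 V) (A B : Matrix ι ι ℂ) (i j k l : ι) :
    𝔼 y, ((V y : Matrix ι ι ℂ)ᴴ * A * (V y : Matrix ι ι ℂ)) i j
        * ((V y : Matrix ι ι ℂ)ᴴ * B * (V y : Matrix ι ι ℂ)) k l =
      ((A.trace * B.trace - (A * B).trace / Fintype.card ι)
          * ((if i = j then 1 else 0) * (if k = l then 1 else 0))
        + ((A * B).trace - A.trace * B.trace / Fintype.card ι)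
          * ((if i = l then 1 else 0) * (if j = k then 1 else 0)))
        / ((Fintype.card ι : ℂ) ^ 2 - 1) := by
  simp only [conj_apply_mul_conj_apply]
  rw [Finset.expect_sum_comm]
  simp only [← Finset.mul_expect, hV.expect_quad, secondMoment]
  generalize ((if i = j then (1 : ℂ) else 0) * (if k = l then 1 else 0)) = s
  generalize ((if i = l then (1 : ℂ) else 0) * (if j = k then 1 else 0)) = t
  have h1 : ∑ x : ι × ι × ι × ι, A x.1 x.2.1 * B x.2.2.1 x.2.2.2
      * ((if x.1 = x.2.1 then 1 else 0) * (if x.2.2.1 = x.2.2.2 then 1 else 0))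
      = A.trace * B.trace := by
    simp [Fintype.sum_prod_type, trace, Finset.sum_mul_sum]
  have h2 : ∑ x : ι × ι × ι × ι, A x.1 x.2.1 * B x.2.2.1 x.2.2.2
      * ((if x.2.1 = x.2.2.1 then 1 else 0) * (if x.1 = x.2.2.2 then 1 else 0))
      = (A * B).trace := by
    simp [Fintype.sum_prod_type, trace, mul_apply]
  rw [← h1, ← h2]
  simp only [Finset.sum_div, Finset.sum_mul, ← Finset.sum_add_distrib, ← Finset.sum_sub_distrib]
  refine Fintype.sum_congr _ _ fun x => ?_
  ring

/-- The average of `V† A V` over a unitary `2`-design. -/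
theorem IsUnitaryDesign.expect_conj [Nontrivial ι] {Y : Type} [Fintype Y]
    {V : Y → unitaryGroup ι ℂ} (hV : IsUnitaryDesign 2 V) (A : Matrix ι ι ℂ) (i j : ι) :
    𝔼 y, ((V y : Matrix ι ι ℂ)ᴴ * A * (V y : Matrix ι ι ℂ)) i j
      = if i = j then A.trace / Fintype.card ι else 0 := by
  have h := hV.expect_conj_mul_conj A 1 i j i i
  have hu : ∀ y, (V y : Matrix ι ι ℂ)ᴴ * (V y : Matrix ι ι ℂ) = 1 := fun y =>
    mem_unitaryGroup_iff'.mp (V y).2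
  have hd : (1 : ℝ) < Fintype.card ι := by exact_mod_cast Fintype.one_lt_card
  have hd0 : (Fintype.card ι : ℂ) ≠ 0 := by
    exact_mod_cast (by positivity : (Fintype.card ι : ℝ) ≠ 0)
  have hd1 : (Fintype.card ι : ℂ) ^ 2 - 1 ≠ 0 := by
    exact_mod_cast (by nlinarith : (Fintype.card ι : ℝ) ^ 2 - 1 ≠ 0)
  simp only [mul_one, hu, one_apply_eq, trace_one] at h
  rw [h]
  by_cases hij : i = j
  · subst hij
    simp only [if_true]
    field_simp
    ring
  · have hji : ¬ j = i := fun h => hij h.symm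
    simp [hij, hji]

/-- The quadratic form of `L` at `V`, viewed as a vector in `ℂ^ι ⊗ ℂ^ι`. -/
noncomputable def vecForm (L : Matrix (ι × ι) (ι × ι) ℂ) (V : Matrix ι ι ℂ) : ℂ :=
  ∑ p, ∑ q, star (V p.1 p.2) * L p q * V q.1 q.2

/-- The average over a `2`-design of the square of a quadratic form in `V` that vanishes on average:
the condition says that the partial trace of `L` over the first factor is zero. -/
theorem IsUnitaryDesign.expect_vecForm_sq [Nontrivial ι] {Y : Type} [Fintype Y]
    {V : Y → unitaryGroup ι ℂ} (hV : IsUnitaryDesign 2 V) (L : Matrix (ι × ι) (ι × ι) ℂ)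
    (hL : ∀ i j, ∑ a, L (a, i) (a, j) = 0) :
    𝔼 y, vecForm L (V y : Matrix ι ι ℂ) ^ 2
      = ((L * L).trace - (∑ a, ∑ b, (∑ i, L (a, i) (b, i)) * ∑ i, L (b, i) (a, i)) / Fintype.card ι)
        / ((Fintype.card ι : ℂ) ^ 2 - 1) := by
  have h : ∀ V : Matrix ι ι ℂ, vecForm L V ^ 2
      = ∑ x : (ι × ι) × (ι × ι), ∑ y : (ι × ι) × (ι × ι), L x.1 x.2 * L y.1 y.2
        * quad x.1.2 x.2.2 y.1.2 y.2.2 V x.1.1 x.2.1 y.1.1 y.2.1 := by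
    intro V
    have : vecForm L V
        = ∑ x : (ι × ι) × (ι × ι), star (V x.1.1 x.1.2) * L x.1 x.2 * V x.2.1 x.2.2 := by
      rw [Fintype.sum_prod_type]; rfl
    rw [sq, this, Finset.sum_mul_sum]
    refine Finset.sum_congr rfl fun x _ => Finset.sum_congr rfl fun y _ => ?_
    simp only [quad]
    ring
  -- the four contractions of `L ⊗ L`
  have h11 : ∑ x : (ι × ι) × (ι × ι), ∑ y : (ι × ι) × (ι × ι), L x.1 x.2 * L y.1 y.2
      * (((if x.1.1 = x.2.1 then 1 else 0) * (if y.1.1 = y.2.1 then 1 else 0))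
        * ((if x.1.2 = x.2.2 then 1 else 0) * (if y.1.2 = y.2.2 then 1 else 0))) = 0 := by
    have : ∑ a, ∑ i, L (a, i) (a, i) = 0 := by
      rw [Finset.sum_comm]; exact Finset.sum_eq_zero fun i _ => hL i i
    simp [Fintype.sum_prod_type, ← Finset.mul_sum, this]
  have h12 : ∑ x : (ι × ι) × (ι × ι), ∑ y : (ι × ι) × (ι × ι), L x.1 x.2 * L y.1 y.2
      * (((if x.1.1 = x.2.1 then 1 else 0) * (if y.1.1 = y.2.1 then 1 else 0))
        * ((if x.1.2 = y.2.2 then 1 else 0) * (if x.2.2 = y.1.2 then 1 else 0))) = 0 := by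
    simp [Fintype.sum_prod_type, ← Finset.mul_sum, hL]
  have h21 : ∑ x : (ι × ι) × (ι × ι), ∑ y : (ι × ι) × (ι × ι), L x.1 x.2 * L y.1 y.2
      * (((if x.2.1 = y.1.1 then 1 else 0) * (if x.1.1 = y.2.1 then 1 else 0))
        * ((if x.1.2 = x.2.2 then 1 else 0) * (if y.1.2 = y.2.2 then 1 else 0)))
      = ∑ a, ∑ b, (∑ i, L (a, i) (b, i)) * ∑ i, L (b, i) (a, i) := by
    simp [Fintype.sum_prod_type, ← Finset.mul_sum]
    refine Finset.sum_congr rfl fun a _ => ?_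
    rw [Finset.sum_comm]
    simp only [Finset.sum_mul]
  have h22 : ∑ x : (ι × ι) × (ι × ι), ∑ y : (ι × ι) × (ι × ι), L x.1 x.2 * L y.1 y.2
      * (((if x.2.1 = y.1.1 then 1 else 0) * (if x.1.1 = y.2.1 then 1 else 0))
        * ((if x.1.2 = y.2.2 then 1 else 0) * (if x.2.2 = y.1.2 then 1 else 0)))
      = (L * L).trace := by
    simp [Fintype.sum_prod_type, trace, mul_apply]
  have hsum : ∀ z₁ z₂ : ℂ, z₁ = 0 → z₂ = 0 →
      ∑ x : (ι × ι) × (ι × ι), ∑ y : (ι × ι) × (ι × ι), L x.1 x.2 * L y.1 y.2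
        * secondMoment x.1.2 x.2.2 y.1.2 y.2.2 x.1.1 x.2.1 y.1.1 y.2.1
      = (z₁ - (∑ a, ∑ b, (∑ i, L (a, i) (b, i)) * ∑ i, L (b, i) (a, i)) / Fintype.card ι
        + (L * L).trace - z₂ / Fintype.card ι) / ((Fintype.card ι : ℂ) ^ 2 - 1) := by
    intro z₁ z₂ h₁ h₂
    rw [h₁.trans h11.symm, h₂.trans h12.symm, ← h21, ← h22]
    simp only [Finset.sum_div, ← Finset.sum_add_distrib, ← Finset.sum_sub_distrib, secondMoment]
    refine Finset.sum_congr rfl fun x _ => Finset.sum_congr rfl fun y _ => ?_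
    ring
  simp only [h]
  simp only [Finset.expect_sum_comm, ← Finset.mul_expect, hV.expect_quad, hsum 0 0 rfl rfl]
  ring

end Twirl

section Frobenius

variable {l m n : Type*} [Fintype l] [Fintype m] [Fintype n]

/-- The squared Frobenius norm. -/
noncomputable def fsq (Z : Matrix m n ℂ) : ℝ := ∑ i, ∑ j, ‖Z i j‖ ^ 2

theorem fsq_nonneg (Z : Matrix m n ℂ) : 0 ≤ fsq Z := by unfold fsq; positivity

theorem fsq_conjTranspose (Z : Matrix m n ℂ) : fsq Zᴴ = fsq Z := by
  unfold fsq; rw [Finset.sum_comm]; simp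

theorem fsq_smul (c : ℂ) (Z : Matrix m n ℂ) : fsq (c • Z) = ‖c‖ ^ 2 * fsq Z := by
  simp [fsq, mul_pow, Finset.mul_sum]

theorem fsq_eq_trace (Z : Matrix m n ℂ) : (fsq Z : ℂ) = (Z * Zᴴ).trace := by
  simp [fsq, trace, mul_apply, Complex.mul_conj']

theorem fsq_sub_le (Z W : Matrix m n ℂ) : fsq (Z - W) ≤ 2 * (fsq Z + fsq W) := by
  simp only [fsq, ← Finset.sum_add_distrib, Finset.mul_sum]
  refine Finset.sum_le_sum fun i _ => Finset.sum_le_sum fun j _ => ?_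
  have h := norm_sub_le (Z i j) (W i j)
  rw [Matrix.sub_apply]
  nlinarith [sq_nonneg (‖Z i j‖ - ‖W i j‖), norm_nonneg (Z i j - W i j), norm_nonneg (Z i j),
    norm_nonneg (W i j)]

end Frobenius

section Commutator

open scoped BigOperators

variable {ι : Type} [Fintype ι]

theorem vecForm_eq (L : Matrix (ι × ι) (ι × ι) ℂ) (V : Matrix ι ι ℂ) :
    vecForm L V = star (Function.uncurry V) ⬝ᵥ (L *ᵥ Function.uncurry V) := by
  simp [vecForm, dotProduct, mulVec, Finset.mul_sum, Function.uncurry, mul_assoc]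

variable [DecidableEq ι]

/-- The quadratic form here is that of the commutator of `iΛ` with an operator `H` on the first
factor. It has zero mean over a `2`-design, and its second moment is controlled by a Frobenius norm. -/
theorem IsUnitaryDesign.expect_commutator_sq_le [Nontrivial ι] {Y : Type} [Fintype Y]
    {V : Y → unitaryGroup ι ℂ} (hV : IsUnitaryDesign 2 V) {Λ : Matrix (ι × ι) (ι × ι) ℂ}
    (hΛ : Λ.IsHermitian) {H : Matrix ι ι ℂ} (hH : H.IsHermitian) :
    𝔼 y, (2 * (star (Function.uncurry (V y : Matrix ι ι ℂ)) ⬝ᵥ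
        ((Complex.I • (Λ * (H ⊗ₖ (1 : Matrix ι ι ℂ)))) *ᵥ
          Function.uncurry (V y : Matrix ι ι ℂ))).re) ^ 2
      ≤ 4 / ((Fintype.card ι : ℝ) ^ 2 - 1) * fsq ((H ⊗ₖ (1 : Matrix ι ι ℂ)) * Λ) := by
  set K := H ⊗ₖ (1 : Matrix ι ι ℂ) with hK
  have hKh : Kᴴ = K := by rw [hK, conjTranspose_kronecker, hH, conjTranspose_one]
  set L : Matrix (ι × ι) (ι × ι) ℂ := Complex.I • (Λ * K - K * Λ) with hLdef
  have hLh : Lᴴ = L := by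
    simp only [hLdef, conjTranspose_smul, conjTranspose_sub, conjTranspose_mul, hKh, hΛ.eq,
      RCLike.star_def, Complex.conj_I]
    rw [neg_smul, ← smul_neg, neg_sub]
  have hL0 : ∀ i j, ∑ a, L (a, i) (a, j) = 0 := by
    intro i j
    simp only [hLdef, Matrix.smul_apply, Matrix.sub_apply, smul_eq_mul, ← Finset.mul_sum,
      Finset.sum_sub_distrib, mul_apply, Fintype.sum_prod_type, hK, kronecker_apply, one_apply]
    simp only [mul_ite, mul_one, mul_zero, Finset.sum_ite_eq', ite_mul, zero_mul, Finset.sum_ite_eq,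
      Finset.mem_univ, if_true]
    rw [Finset.sum_comm]
    simp [mul_comm]
  have hform : ∀ V : Matrix ι ι ℂ, vecForm L V
      = ((2 * (star (Function.uncurry V) ⬝ᵥ
          ((Complex.I • (Λ * K)) *ᵥ Function.uncurry V)).re : ℝ) : ℂ) := by
    intro V
    have h1 : L = Complex.I • (Λ * K) + (Complex.I • (Λ * K))ᴴ := by
      simp only [hLdef, conjTranspose_smul, conjTranspose_mul, hKh, hΛ.eq, RCLike.star_def,
        Complex.conj_I, neg_smul, sub_eq_add_neg, smul_add, smul_neg]
    rw [vecForm_eq, h1, add_mulVec, dotProduct_add]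
    have h2 : ∀ (v : ι × ι → ℂ) (Z : Matrix (ι × ι) (ι × ι) ℂ),
        star v ⬝ᵥ (Zᴴ *ᵥ v) = star (star v ⬝ᵥ (Z *ᵥ v)) := by
      intro v Z
      rw [star_dotProduct, star_mulVec, conjTranspose_conjTranspose, ← dotProduct_mulVec]
    rw [h2]
    push_cast
    rw [Complex.re_eq_add_conj]
    simp
    ring
  have hsq := hV.expect_vecForm_sq L hL0
  have hre : 𝔼 y, (2 * (star (Function.uncurry (V y : Matrix ι ι ℂ)) ⬝ᵥ
        ((Complex.I • (Λ * K)) *ᵥ Function.uncurry (V y : Matrix ι ι ℂ))).re) ^ 2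
      = (fsq L - (∑ a, ∑ b, ‖∑ i, L (a, i) (b, i)‖ ^ 2) / Fintype.card ι)
        / ((Fintype.card ι : ℝ) ^ 2 - 1) := by
    have hκ : ∀ a b, (∑ i, L (a, i) (b, i)) * ∑ i, L (b, i) (a, i)
        = ((‖∑ i, L (a, i) (b, i)‖ ^ 2 : ℝ) : ℂ) := by
      intro a b
      rw [Complex.ofReal_pow, ← Complex.mul_conj', map_sum]
      congr 1
      refine Finset.sum_congr rfl fun i _ => ?_
      exact (congrFun (congrFun hLh (b, i)) (a, i)).symm
    have hf := fsq_eq_trace L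
    rw [hLh] at hf
    simp only [hform, hκ, ← hf] at hsq
    have : ∀ f : Y → ℝ, ((𝔼 y, f y : ℝ) : ℂ) = 𝔼 y, (f y : ℂ) := by
      intro f; simp [Fintype.expect_eq_sum_div_card]
    apply Complex.ofReal_injective
    rw [this]
    push_cast at hsq ⊢
    exact hsq
  have hd : (1 : ℝ) < Fintype.card ι := by exact_mod_cast Fintype.one_lt_card
  have hd1 : 0 < (Fintype.card ι : ℝ) ^ 2 - 1 := by nlinarith
  have hΛK : fsq (Λ * K) = fsq (K * Λ) := by
    rw [← fsq_conjTranspose, conjTranspose_mul, hKh, hΛ.eq]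
  have hLf : fsq L ≤ 4 * fsq (K * Λ) := by
    rw [hLdef, fsq_smul]
    have := fsq_sub_le (Λ * K) (K * Λ)
    rw [hΛK] at this
    simp
    linarith
  rw [hre, div_mul_eq_mul_div]
  gcongr
  have : 0 ≤ (∑ a, ∑ b, ‖∑ i, L (a, i) (b, i)‖ ^ 2) / (Fintype.card ι : ℝ) := by positivity
  linarith

end Commutator

/-! ### Operators that act on the inputs and one output qubit -/

section Sites

variable {n : ℕ}

/-- The part of a network label that the perceptron of output qubit `k` acts on. -/
def site (k : Fin n) (p : NBits n) : PBits n := (p.1, p.2 k)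

/-- The network label `p` with its part at the perceptron of output qubit `k` replaced by `x`. -/
def put (k : Fin n) (x : PBits n) (p : NBits n) : NBits n := (x.1, Function.update p.2 k x.2)

@[simp] theorem site_put (k : Fin n) (x : PBits n) (p : NBits n) : site k (put k x p) = x := by
  simp [site, put]

@[simp] theorem put_put (k : Fin n) (x y : PBits n) (p : NBits n) :
    put k x (put k y p) = put k x p := by
  simp [put]

@[simp] theorem put_site (k : Fin n) (p : NBits n) : put k (site k p) p = p := by
  simp [site, put]

theorem agree_iff (k : Fin n) (p q : NBits n) :
    (∀ i, i ≠ k → p.2 i = q.2 i) ↔ put k (site k q) p = q := by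
  constructor
  · intro h
    refine Prod.ext rfl ?_
    funext i
    by_cases hi : i = k
    · subst hi; simp [put, site]
    · simp [put, site, hi, h i hi]
  · intro h i hi
    rw [← h]
    simp [put, hi]

theorem sum_agree {E : Type*} [AddCommMonoid E] (k : Fin n) (p : NBits n) (F : NBits n → E) :
    ∑ s : NBits n, (if ∀ i, i ≠ k → p.2 i = s.2 i then F s else 0) = ∑ x, F (put k x p) := by
  rw [← Finset.sum_filter]
  refine Finset.sum_nbij' (fun s => site k s) (fun x => put k x p) ?_ ?_ ?_ ?_ ?_
  · simp
  · intro x _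
    simp [agree_iff]
  · intro s hs
    exact (agree_iff k p s).mp (Finset.mem_filter.mp hs).2
  · simp
  · intro s hs
    rw [(agree_iff k p s).mp (Finset.mem_filter.mp hs).2]

theorem sum_put {E : Type*} [AddCommMonoid E] (k : Fin n) (b : PBits n) (F : NBits n → E) :
    ∑ i, ∑ t, (if site k t = b then F (put k i t) else 0) = ∑ s, F s := by
  rw [← Fintype.sum_prod_type', ← Finset.sum_filter]
  refine Finset.sum_nbij' (fun x => put k x.1 x.2) (fun s => (site k s, put k b s)) ?_ ?_ ?_ ?_ ?_
  · simp
  · simp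
  · rintro ⟨i, t⟩ h
    have : site k t = b := by simpa using h
    simp [← this]
  · simp
  · simp

theorem onInputAnd_mul_apply {m : Type*} (k : Fin n) (W : Matrix (PBits n) (PBits n) ℂ)
    (M : Matrix (NBits n) m ℂ) (p : NBits n) (q : m) :
    (onInputAnd k W * M) p q = ∑ x, W (site k p) x * M (put k x p) q := by
  have := sum_agree k p fun s => W (site k p) (site k s) * M s q
  simp only [site_put] at this
  rw [mul_apply, ← this]
  simp [onInputAnd, site]

theorem mul_onInputAnd_apply {m : Type*} (k : Fin n) (W : Matrix (PBits n) (PBits n) ℂ)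
    (M : Matrix m (NBits n) ℂ) (p : m) (q : NBits n) :
    (M * onInputAnd k W) p q = ∑ x, M p (put k x q) * W x (site k q) := by
  have := sum_agree k q fun s => M p s * W (site k s) (site k q)
  simp only [site_put] at this
  rw [mul_apply, ← this]
  simp [onInputAnd, site, eq_comm]

theorem onInputAnd_mulVec (k : Fin n) (W : Matrix (PBits n) (PBits n) ℂ) (v : NBits n → ℂ)
    (p : NBits n) : (onInputAnd k W *ᵥ v) p = ∑ x, W (site k p) x * v (put k x p) := by
  have := sum_agree k p fun s => W (site k p) (site k s) * v s
  simp only [site_put] at this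
  rw [mulVec, dotProduct, ← this]
  simp [onInputAnd, site]

theorem onInputAnd_conjTranspose (k : Fin n) (W : Matrix (PBits n) (PBits n) ℂ) :
    (onInputAnd k W)ᴴ = onInputAnd k Wᴴ := by
  ext p q
  simp only [onInputAnd, conjTranspose_apply, of_apply, eq_comm, apply_ite star, star_zero]

theorem onInputAnd_smul (k : Fin n) (c : ℂ) (W : Matrix (PBits n) (PBits n) ℂ) :
    onInputAnd k (c • W) = c • onInputAnd k W := by
  ext p q
  simp [onInputAnd]

end Sites

/-! ### The second moment of the force on one perceptron -/

section Force

open scoped BigOperators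

variable {n : ℕ}

/-- The network vector `u` as an operator from the network to two copies of the space of the
perceptron `k`; the second copy records the part of `u` on that space. -/
def slotMatrix (k : Fin n) (u : NBits n → ℂ) : Matrix (PBits n × PBits n) (NBits n) ℂ :=
  of fun x s => if site k s = x.1 then star (u (put k x.2 s)) else 0

theorem slotMatrix_conjTranspose_mulVec (k : Fin n) (u : NBits n → ℂ)
    (V : Matrix (PBits n) (PBits n) ℂ) :
    (slotMatrix k u)ᴴ *ᵥ Function.uncurry V = onInputAnd k V *ᵥ u := by
  ext s
  rw [onInputAnd_mulVec]
  simp only [mulVec, dotProduct, slotMatrix, conjTranspose_apply, of_apply, apply_ite star,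
    star_star, star_zero, Function.uncurry, Fintype.sum_prod_type (α₁ := PBits n) (α₂ := PBits n),
    ite_mul, zero_mul, Finset.sum_ite_irrel, Finset.sum_const_zero, Finset.sum_ite_eq, Finset.mem_univ,
    if_true]
  exact Finset.sum_congr rfl fun _ _ => mul_comm _ _

theorem kronecker_mul_slotMatrix_apply (k : Fin n) (u : NBits n → ℂ)
    (H : Matrix (PBits n) (PBits n) ℂ) (a i : PBits n) (t : NBits n) :
    ((H ⊗ₖ (1 : Matrix (PBits n) (PBits n) ℂ)) * slotMatrix k u) (a, i) t
      = H a (site k t) * star (u (put k i t)) := by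
  simp only [slotMatrix, of_apply, mul_apply, kronecker_apply, one_apply,
    Fintype.sum_prod_type (α₁ := PBits n) (α₂ := PBits n)]
  simp

theorem slotMatrix_mul_onInputAnd (k : Fin n) (u : NBits n → ℂ)
    (H : Matrix (PBits n) (PBits n) ℂ) :
    slotMatrix k u * onInputAnd k H
      = (H ⊗ₖ (1 : Matrix (PBits n) (PBits n) ℂ)) * slotMatrix k u := by
  ext ⟨a, i⟩ t
  rw [mul_onInputAnd_apply, kronecker_mul_slotMatrix_apply]
  simp only [slotMatrix, of_apply, site_put, put_put, ite_mul, zero_mul, Finset.sum_ite_eq',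
    Finset.mem_univ, if_true]
  exact mul_comm _ _

theorem fsq_mul_slotMatrix_conjTranspose_le {m : Type*} [Fintype m] (k : Fin n) (u : NBits n → ℂ)
    (Z : Matrix m (NBits n) ℂ) :
    fsq (Z * (slotMatrix k u)ᴴ) ≤ fsq Z * ∑ s, ‖u s‖ ^ 2 := by
  have entry : ∀ p b i, ‖(Z * (slotMatrix k u)ᴴ) p (b, i)‖ ^ 2
      ≤ (∑ t, if site k t = b then ‖Z p t‖ ^ 2 else 0)
        * ∑ t, if site k t = b then ‖u (put k i t)‖ ^ 2 else 0 := by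
    intro p b i
    have h1 : ‖(Z * (slotMatrix k u)ᴴ) p (b, i)‖
        ≤ ∑ t, (if site k t = b then ‖Z p t‖ else 0)
          * (if site k t = b then ‖u (put k i t)‖ else 0) := by
      rw [mul_apply]
      refine (norm_sum_le _ _).trans (Finset.sum_le_sum fun t _ => ?_)
      simp only [slotMatrix, conjTranspose_apply, of_apply]
      split_ifs <;> simp
    calc _ ≤ (∑ t, (if site k t = b then ‖Z p t‖ else 0)
          * (if site k t = b then ‖u (put k i t)‖ else 0)) ^ 2 := by gcongr
      _ ≤ _ := Finset.sum_mul_sq_le_sq_mul_sq _ _ _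
      _ = _ := by simp [ite_pow]
  calc fsq (Z * (slotMatrix k u)ᴴ)
      = ∑ p, ∑ b, ∑ i, ‖(Z * (slotMatrix k u)ᴴ) p (b, i)‖ ^ 2 := by
        simp only [fsq, Fintype.sum_prod_type]
    _ ≤ ∑ p, ∑ b, ∑ i, (∑ t, if site k t = b then ‖Z p t‖ ^ 2 else 0)
        * ∑ t, if site k t = b then ‖u (put k i t)‖ ^ 2 else 0 := by
        gcongr; apply entry
    _ = fsq Z * ∑ s, ‖u s‖ ^ 2 := by
        simp only [← Finset.mul_sum, sum_put k _ fun s => ‖u s‖ ^ 2, ← Finset.sum_mul]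
        congr 1
        unfold fsq
        refine Finset.sum_congr rfl fun p _ => ?_
        rw [Finset.sum_comm]
        simp

theorem fsq_kronecker_mul_slotMatrix (k : Fin n) (u : NBits n → ℂ)
    (H : Matrix (PBits n) (PBits n) ℂ) :
    fsq ((H ⊗ₖ (1 : Matrix (PBits n) (PBits n) ℂ)) * slotMatrix k u)
      = fsq H * ∑ s, ‖u s‖ ^ 2 := by
  simp only [fsq, Fintype.sum_prod_type (α₁ := PBits n) (α₂ := PBits n),
    kronecker_mul_slotMatrix_apply, Finset.sum_mul,
    norm_mul, norm_star, mul_pow]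
  refine Finset.sum_congr rfl fun a _ => ?_
  have h2 : ∀ i t, ‖H a (site k t)‖ ^ 2 * ‖u (put k i t)‖ ^ 2
      = ∑ b, ‖H a b‖ ^ 2 * if site k t = b then ‖u (put k i t)‖ ^ 2 else 0 := by
    intro i t
    simp only [mul_ite, mul_zero, Finset.sum_ite_eq, Finset.mem_univ, if_true]
  simp_rw [h2]
  simp_rw [Finset.sum_comm (s := (Finset.univ : Finset (NBits n)))]
  rw [Finset.sum_comm]
  simp only [← Finset.mul_sum]
  refine Finset.sum_congr rfl fun b _ => ?_
  rw [← sum_put k b]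

/-- The rate at which the expectation value of `M` in the state `ψ` changes when `ψ` is rotated by
`e^{iεH}` at the perceptron `k`. -/
def force (k : Fin n) (H : Matrix (PBits n) (PBits n) ℂ) (M : Matrix (NBits n) (NBits n) ℂ)
    (ψ : NBits n → ℂ) : ℝ :=
  2 * (star ψ ⬝ᵥ (M *ᵥ (onInputAnd k (Complex.I • H) *ᵥ ψ))).re

theorem force_sub_smul_one (k : Fin n) {H : Matrix (PBits n) (PBits n) ℂ} (hH : H.IsHermitian)
    (M : Matrix (NBits n) (NBits n) ℂ) (c : ℝ) (ψ : NBits n → ℂ) :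
    force k H (M - (c : ℂ) • 1) ψ = force k H M ψ := by
  have h : (star ψ ⬝ᵥ (onInputAnd k (Complex.I • H) *ᵥ ψ)).re = 0 := by
    have h1 : star (star ψ ⬝ᵥ (onInputAnd k H *ᵥ ψ)) = star ψ ⬝ᵥ (onInputAnd k H *ᵥ ψ) := by
      rw [← star_dotProduct, star_mulVec, onInputAnd_conjTranspose, hH, ← dotProduct_mulVec]
    have h2 := Complex.conj_eq_iff_im.mp h1
    simp [onInputAnd_smul, smul_mulVec, h2]
  rw [force, force, sub_mulVec, dotProduct_sub, smul_mulVec, one_mulVec, dotProduct_smul,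
    Complex.sub_re, smul_eq_mul, Complex.re_ofReal_mul, h]
  simp

/-- The mean square of the force on the perceptron `k`, averaged over a `2`-design for that
perceptron. The constant `c` is arbitrary. -/
theorem IsUnitaryDesign.expect_force_sq_le (k : Fin n) {Y : Type} [Fintype Y]
    {V : Y → unitaryGroup (PBits n) ℂ} (hV : IsUnitaryDesign 2 V)
    {H : Matrix (PBits n) (PBits n) ℂ} (hH : H.IsHermitian)
    {M : Matrix (NBits n) (NBits n) ℂ} (hM : M.IsHermitian) (c : ℝ) (u : NBits n → ℂ) :
    𝔼 y, force k H M (onInputAnd k (V y : Matrix (PBits n) (PBits n) ℂ) *ᵥ u) ^ 2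
      ≤ 4 / ((2 ^ (n + 1) : ℝ) ^ 2 - 1) * (fsq ((H ⊗ₖ (1 : Matrix (PBits n) (PBits n) ℂ)) *
          slotMatrix k u * (M - (c : ℂ) • 1)) * ∑ s, ‖u s‖ ^ 2) := by
  set Y' := slotMatrix k u
  set A := M - (c : ℂ) • 1 with hA
  have hAh : A.IsHermitian := by
    rw [hA, IsHermitian, conjTranspose_sub, hM, conjTranspose_smul]
    simp
  have hΛ : (Y' * A * Y'ᴴ).IsHermitian := isHermitian_mul_mul_conjTranspose _ hAh
  have key := hV.expect_commutator_sq_le hΛ hH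
  have hcard : (Fintype.card (PBits n) : ℝ) = 2 ^ (n + 1) := by
    simp [PBits, Bits, pow_succ]
  have hf : ∀ y, force k H M (onInputAnd k (V y : Matrix (PBits n) (PBits n) ℂ) *ᵥ u)
      = 2 * (star (Function.uncurry (V y : Matrix (PBits n) (PBits n) ℂ)) ⬝ᵥ
        ((Complex.I • (Y' * A * Y'ᴴ * (H ⊗ₖ (1 : Matrix (PBits n) (PBits n) ℂ)))) *ᵥ
          Function.uncurry (V y : Matrix (PBits n) (PBits n) ℂ))).re := by
    intro y
    have h1 : Y'ᴴ * (H ⊗ₖ (1 : Matrix (PBits n) (PBits n) ℂ)) = onInputAnd k H * Y'ᴴ := by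
      have := congrArg conjTranspose (slotMatrix_mul_onInputAnd k u H)
      rw [conjTranspose_mul, conjTranspose_mul, onInputAnd_conjTranspose, hH,
        conjTranspose_kronecker, hH, conjTranspose_one] at this
      exact this.symm
    rw [← force_sub_smul_one k hH M c, ← hA, force, ← slotMatrix_conjTranspose_mulVec, star_mulVec,
      conjTranspose_conjTranspose, ← dotProduct_mulVec, onInputAnd_smul, Matrix.mul_assoc _ Y'ᴴ, h1]
    simp only [mulVec_mulVec, smul_mulVec, mulVec_smul, Matrix.smul_mul, Matrix.mul_assoc, Y']
  simp only [hf]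
  refine key.trans ?_
  rw [hcard, ← Matrix.mul_assoc, ← Matrix.mul_assoc]
  have h0 : (1 : ℝ) < 2 ^ (n + 1) := one_lt_pow₀ (by norm_num) (by omega)
  have : 0 ≤ 4 / ((2 ^ (n + 1) : ℝ) ^ 2 - 1) := by
    apply div_nonneg <;> nlinarith
  exact mul_le_mul_of_nonneg_left (fsq_mul_slotMatrix_conjTranspose_le k u _) this

end Force

/-! ### The Heisenberg picture -/

section Heisenberg

open scoped ComplexOrder

variable {n : ℕ}

theorem onInputAnd_mul_onInputAnd (k : Fin n) (A B : Matrix (PBits n) (PBits n) ℂ) :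
    onInputAnd k A * onInputAnd k B = onInputAnd k (A * B) := by
  ext p q
  rw [onInputAnd_mul_apply]
  by_cases h : ∀ i, i ≠ k → p.2 i = q.2 i
  · have h' : ∀ x : PBits n, ∀ i, i ≠ k → (put k x p).2 i = q.2 i := by
      intro x i hi
      simpa [put, hi] using h i hi
    simp only [onInputAnd, of_apply, if_pos h, if_pos (h' _), mul_apply]
    refine Finset.sum_congr rfl fun x _ => ?_
    simp [put, site]
  · have h' : ∀ x : PBits n, ¬ ∀ i, i ≠ k → (put k x p).2 i = q.2 i := by
      intro x hx
      refine h fun i hi => ?_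
      simpa [put, hi] using hx i hi
    simp only [onInputAnd, of_apply, if_neg h, if_neg (h' _), mul_zero, Finset.sum_const_zero]

theorem onInputAnd_one (k : Fin n) : onInputAnd k (1 : Matrix (PBits n) (PBits n) ℂ) = 1 := by
  ext p q
  have : p = q ↔ (∀ i, i ≠ k → p.2 i = q.2 i) ∧ (p.1, p.2 k) = (q.1, q.2 k) := by
    constructor
    · rintro rfl; simp
    · rintro ⟨h1, h2⟩
      rw [agree_iff] at h1
      rw [← h1, ← put_site k p]
      simp only [put_put]
      rw [show site k p = site k q from h2]
  simp only [onInputAnd, of_apply, one_apply, this, ite_and]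

/-- The block of `M` at the perceptron `k`, for fixed states of the other output qubits. -/
def block (k : Fin n) (M : Matrix (NBits n) (NBits n) ℂ) (p q : NBits n) :
    Matrix (PBits n) (PBits n) ℂ :=
  of fun x y => M (put k x p) (put k y q)

theorem conj_onInputAnd_apply (k : Fin n) (V : Matrix (PBits n) (PBits n) ℂ)
    (M : Matrix (NBits n) (NBits n) ℂ) (p q : NBits n) :
    ((onInputAnd k V)ᴴ * M * onInputAnd k V) p q
      = (Vᴴ * block k M p q * V) (site k p) (site k q) := by
  rw [mul_onInputAnd_apply, onInputAnd_conjTranspose]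
  simp only [onInputAnd_mul_apply]
  simp [mul_apply, block]

/-- One step of the backward evolution of observables: conjugation with the perceptron `V` of the
output qubit `k`, then the expectation value in the initial state `|0⟩` of that qubit. The result
acts as the identity on output qubit `k`. -/
def pull (k : Fin n) (V : Matrix (PBits n) (PBits n) ℂ) (M : Matrix (NBits n) (NBits n) ℂ) :
    Matrix (NBits n) (NBits n) ℂ :=
  of fun p q => if p.2 k = q.2 k then (Vᴴ * block k M p q * V) (p.1, 0) (q.1, 0) else 0

theorem pull_sub (k : Fin n) (V : Matrix (PBits n) (PBits n) ℂ)
    (M N : Matrix (NBits n) (NBits n) ℂ) : pull k V (M - N) = pull k V M - pull k V N := by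
  have h : ∀ p q, block k (M - N) p q = block k M p q - block k N p q := fun p q => rfl
  ext p q
  simp only [pull, of_apply, h, Matrix.sub_apply, Matrix.mul_sub, Matrix.sub_mul]
  split_ifs <;> simp

theorem block_onInputAnd (k : Fin n) (W : Matrix (PBits n) (PBits n) ℂ) (p q : NBits n) :
    block k (onInputAnd k W) p q = if ∀ i, i ≠ k → p.2 i = q.2 i then W else 0 := by
  ext x y
  have : (∀ i, i ≠ k → (put k x p).2 i = (put k y q).2 i) ↔ ∀ i, i ≠ k → p.2 i = q.2 i := by
    refine forall_congr' fun i => forall_congr' fun hi => ?_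
    simp [put, hi]
  simp only [block, onInputAnd, of_apply, this]
  by_cases h : ∀ i, i ≠ k → p.2 i = q.2 i
  · rw [if_pos h, if_pos h]
    change W (site k (put k x p)) (site k (put k y q)) = W x y
    rw [site_put, site_put]
  · rw [if_neg h, if_neg h]; rfl

theorem block_one (k : Fin n) (p q : NBits n) :
    block k 1 p q = if ∀ i, i ≠ k → p.2 i = q.2 i then 1 else 0 := by
  rw [← onInputAnd_one k, block_onInputAnd]

theorem eq_iff_agree (k : Fin n) (p q : NBits n) :
    p = q ↔ (∀ i, i ≠ k → p.2 i = q.2 i) ∧ p.1 = q.1 ∧ p.2 k = q.2 k := by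
  constructor
  · rintro rfl; simp
  · rintro ⟨h1, h2, h3⟩
    refine Prod.ext h2 (funext fun i => ?_)
    by_cases hi : i = k
    · rw [hi, h3]
    · exact h1 i hi

theorem pull_one (k : Fin n) {V : Matrix (PBits n) (PBits n) ℂ}
    (hV : V ∈ unitaryGroup (PBits n) ℂ) : pull k V 1 = 1 := by
  have hu : Vᴴ * V = 1 := mem_unitaryGroup_iff'.mp hV
  ext p q
  simp only [pull, of_apply, block_one, one_apply, eq_iff_agree k p q]
  by_cases h : ∀ i, i ≠ k → p.2 i = q.2 i
  · simp only [if_pos h, and_iff_right h]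
    by_cases h3 : p.2 k = q.2 k <;> simp [h3, hu, one_apply]
  · rw [if_neg h]
    simp [h]

theorem pull_posSemidef (k : Fin n) (V : Matrix (PBits n) (PBits n) ℂ)
    {M : Matrix (NBits n) (NBits n) ℂ} (hM : M.PosSemidef) : (pull k V M).PosSemidef := by
  -- the Kraus form: for each state `b` of qubit `k`, `E b` resets the qubit from `b` to `0`
  let E : Fin 2 → Matrix (NBits n) (NBits n) ℂ := fun b =>
    of fun s q => if q.2 k = b ∧ s = put k (q.1, 0) q then 1 else 0
  have h : pull k V M = ∑ b, (E b)ᴴ * ((onInputAnd k V)ᴴ * M * onInputAnd k V) * E b := by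
    ext p q
    simp only [Matrix.sum_apply]
    have h1 : ∀ b (Z : Matrix (NBits n) (NBits n) ℂ), ((E b)ᴴ * Z * E b) p q
        = if q.2 k = b ∧ p.2 k = b then Z (put k (p.1, 0) p) (put k (q.1, 0) q) else 0 := by
      intro b Z
      by_cases hq : q.2 k = b <;> by_cases hp : p.2 k = b <;>
        simp [mul_apply, E, hp, hq, apply_ite (starRingEnd ℂ)]
    simp only [h1, conj_onInputAnd_apply, pull, of_apply, site_put]
    have hb : block k M (put k (p.1, 0) p) (put k (q.1, 0) q) = block k M p q := by
      ext x y; simp [block]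
    rw [hb]
    by_cases hpq : p.2 k = q.2 k
    · simp [hpq]
    · rw [if_neg hpq, Finset.sum_eq_zero]
      intro b _
      rw [if_neg]
      rintro ⟨h1, h2⟩
      exact hpq (h2.trans h1.symm)
  rw [h]
  exact posSemidef_sum _ fun b _ =>
    (hM.conjTranspose_mul_mul_same _).conjTranspose_mul_mul_same _

/-- `pull` computes matrix elements between states in which the output qubit `k` is `|0⟩` before the
perceptron acts. -/
theorem star_dotProduct_pull_mulVec (k : Fin n) (V : Matrix (PBits n) (PBits n) ℂ)
    (M : Matrix (NBits n) (NBits n) ℂ) {u v : NBits n → ℂ} (hu : ∀ p, p.2 k ≠ 0 → u p = 0)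
    (hv : ∀ p, p.2 k ≠ 0 → v p = 0) :
    star u ⬝ᵥ (pull k V M *ᵥ v)
      = star (onInputAnd k V *ᵥ u) ⬝ᵥ (M *ᵥ (onInputAnd k V *ᵥ v)) := by
  rw [star_mulVec, ← dotProduct_mulVec, mulVec_mulVec, mulVec_mulVec]
  simp only [dotProduct, mulVec, Finset.mul_sum, Pi.star_apply]
  refine Finset.sum_congr rfl fun p _ => Finset.sum_congr rfl fun q _ => ?_
  by_cases hp : p.2 k = 0
  · by_cases hq : q.2 k = 0
    · rw [conj_onInputAnd_apply]
      simp [pull, hp, hq, site]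
    · simp [hv q hq]
  · simp [hu p hp]

/-- The state of the network after the first `i` perceptrons have acted on `u`. -/
def stateAfter (V : Fin n → Matrix (PBits n) (PBits n) ℂ) (u : NBits n → ℂ) (i : ℕ) : NBits n → ℂ :=
  ((List.ofFn fun j => onInputAnd j (V j)).take i).reverse.prod *ᵥ u

theorem stateAfter_zero (V : Fin n → Matrix (PBits n) (PBits n) ℂ) (u : NBits n → ℂ) :
    stateAfter V u 0 = u := by simp [stateAfter]

theorem stateAfter_succ (V : Fin n → Matrix (PBits n) (PBits n) ℂ) (u : NBits n → ℂ) (k : Fin n) :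
    stateAfter V u (k + 1) = onInputAnd k (V k) *ᵥ stateAfter V u k := by
  rw [stateAfter, List.take_succ_eq_append_getElem (by simp)]
  simp [stateAfter, mulVec_mulVec]

theorem stateAfter_all (V : Fin n → Matrix (PBits n) (PBits n) ℂ) (u : NBits n → ℂ) :
    stateAfter V u n = network V *ᵥ u := by
  rw [stateAfter, network, List.take_of_length_le (by simp)]

theorem stateAfter_congr {V W : Fin n → Matrix (PBits n) (PBits n) ℂ} (u : NBits n → ℂ) :
    ∀ i ≤ n, (∀ j : Fin n, (j : ℕ) < i → V j = W j) → stateAfter V u i = stateAfter W u i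
  | 0, _, _ => by simp [stateAfter_zero]
  | i + 1, hi, h => by
    have h1 := stateAfter_succ V u ⟨i, hi⟩
    have h2 := stateAfter_succ W u ⟨i, hi⟩
    simp only at h1 h2
    rw [h1, h2, h ⟨i, hi⟩ (by simp), stateAfter_congr u i (by omega) fun j hj => h j (by omega)]

/-- The output qubits from number `i` on are in their initial state `|0⟩`. -/
def ZeroFrom (i : ℕ) (u : NBits n → ℂ) : Prop := ∀ p, ∀ k : Fin n, i ≤ k → p.2 k ≠ 0 → u p = 0

theorem ZeroFrom.stateAfter {u : NBits n → ℂ} (hu : ZeroFrom 0 u)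
    (V : Fin n → Matrix (PBits n) (PBits n) ℂ) : ∀ i ≤ n, ZeroFrom i (stateAfter V u i)
  | 0, _ => by rwa [stateAfter_zero]
  | i + 1, hi => by
    have h1 := stateAfter_succ V u ⟨i, hi⟩
    simp only at h1
    intro p k hk hp
    rw [h1, onInputAnd_mulVec]
    refine Finset.sum_eq_zero fun x _ => ?_
    have hki : k ≠ ⟨i, hi⟩ := by rintro rfl; simp at hk
    rw [ZeroFrom.stateAfter hu V i (by omega) _ k (by omega) (by simpa [put, hki] using hp),
      mul_zero]

theorem sum_norm_sq_eq {m : Type*} [Fintype m] (u : m → ℂ) :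
    ((∑ s, ‖u s‖ ^ 2 : ℝ) : ℂ) = star u ⬝ᵥ u := by
  simp [dotProduct, Complex.conj_mul']

theorem sum_norm_sq_stateAfter {V : Fin n → Matrix (PBits n) (PBits n) ℂ}
    (hV : ∀ j, V j ∈ unitaryGroup (PBits n) ℂ) (u : NBits n → ℂ) :
    ∀ i ≤ n, ∑ s, ‖stateAfter V u i s‖ ^ 2 = ∑ s, ‖u s‖ ^ 2
  | 0, _ => by rw [stateAfter_zero]
  | i + 1, hi => by
    rw [← sum_norm_sq_stateAfter hV u i (by omega)]
    have h1 := stateAfter_succ V u ⟨i, hi⟩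
    simp only at h1
    apply Complex.ofReal_injective
    have hu : (V ⟨i, hi⟩)ᴴ * V ⟨i, hi⟩ = 1 := mem_unitaryGroup_iff'.mp (hV _)
    rw [sum_norm_sq_eq, sum_norm_sq_eq, h1, star_mulVec, ← dotProduct_mulVec, mulVec_mulVec,
      onInputAnd_conjTranspose, onInputAnd_mul_onInputAnd, hu, onInputAnd_one, one_mulVec]

/-- The observable `M` on the whole network, pulled back through all perceptrons from number `i`
on. -/
def heis (V : Fin n → Matrix (PBits n) (PBits n) ℂ) (M : Matrix (NBits n) (NBits n) ℂ)
    (i : Fin (n + 1)) : Matrix (NBits n) (NBits n) ℂ :=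
  Fin.reverseInduction (motive := fun _ => Matrix (NBits n) (NBits n) ℂ) M
    (fun k Z => pull k (V k) Z) i

theorem heis_last (V : Fin n → Matrix (PBits n) (PBits n) ℂ) (M : Matrix (NBits n) (NBits n) ℂ) :
    heis V M (Fin.last n) = M := by simp [heis]

theorem heis_castSucc (V : Fin n → Matrix (PBits n) (PBits n) ℂ)
    (M : Matrix (NBits n) (NBits n) ℂ) (k : Fin n) :
    heis V M k.castSucc = pull k (V k) (heis V M k.succ) := by simp [heis]

theorem heis_congr {V W : Fin n → Matrix (PBits n) (PBits n) ℂ} (M : Matrix (NBits n) (NBits n) ℂ)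
    (i : Fin (n + 1)) : (∀ j : Fin n, (i : ℕ) ≤ j → V j = W j) → heis V M i = heis W M i := by
  induction i using Fin.reverseInduction with
  | last => intro _; simp [heis_last]
  | cast k ih =>
    intro h
    rw [heis_castSucc, heis_castSucc, h k (by simp), ih fun j hj => h j (by simp at hj ⊢; omega)]

theorem heis_posSemidef (V : Fin n → Matrix (PBits n) (PBits n) ℂ)
    {M : Matrix (NBits n) (NBits n) ℂ} (hM : M.PosSemidef) (i : Fin (n + 1)) :
    (heis V M i).PosSemidef := by
  induction i using Fin.reverseInduction with
  | last => rwa [heis_last]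
  | cast k ih => rw [heis_castSucc]; exact pull_posSemidef _ _ ih

theorem heis_one_sub {V : Fin n → Matrix (PBits n) (PBits n) ℂ}
    (hV : ∀ j, V j ∈ unitaryGroup (PBits n) ℂ) (M : Matrix (NBits n) (NBits n) ℂ)
    (i : Fin (n + 1)) : heis V (1 - M) i = 1 - heis V M i := by
  induction i using Fin.reverseInduction with
  | last => simp [heis_last]
  | cast k ih => rw [heis_castSucc, ih, pull_sub, pull_one k (hV k), heis_castSucc]

end Heisenberg

/-! ### The derivative of the cost -/

section Derivative

variable {n : ℕ}

/-- The input state `φ` of the network together with the initial state of the output layer. -/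
def inputState (φ : Bits n → ℂ) : NBits n → ℂ := fun p => φ p.1 * zeroState n p.2

theorem zeroFrom_inputState (φ : Bits n → ℂ) : ZeroFrom 0 (inputState φ) := by
  intro p k _ hp
  have : p.2 ≠ 0 := fun h => hp (by rw [h]; rfl)
  simp [inputState, zeroState, this]

theorem sum_norm_sq_inputState {φ : Bits n → ℂ} (hφ : IsState φ) :
    ∑ s, ‖inputState φ s‖ ^ 2 = 1 := by
  rw [Fintype.sum_prod_type, ← hφ]
  refine Finset.sum_congr rfl fun a _ => ?_
  rw [Finset.sum_eq_single 0]
  · simp [inputState, zeroState]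
  · intro b _ hb; simp [inputState, zeroState, hb]
  · simp

theorem trace_mul_outState (V : Fin n → Matrix (PBits n) (PBits n) ℂ) (φ : Bits n → ℂ)
    (O : Matrix (Bits n) (Bits n) ℂ) :
    (O * outState V (proj φ)).trace = star (stateAfter V (inputState φ) n) ⬝ᵥ
      (((1 : Matrix (Bits n) (Bits n) ℂ) ⊗ₖ O) *ᵥ stateAfter V (inputState φ) n) := by
  have h : proj φ ⊗ₖ proj (zeroState n) = vecMulVec (inputState φ) (star (inputState φ)) := by
    ext p q
    simp [proj, vecMulVec_apply, inputState]
    ring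
  rw [outState, h, mul_vecMulVec, vecMulVec_mul, stateAfter_all, ← star_mulVec]
  generalize network V *ᵥ inputState φ = ψ
  have hl : (O * traceIn (vecMulVec ψ (star ψ))).trace
      = ∑ b, ∑ c, ∑ a, star (ψ (a, b)) * (O b c * ψ (a, c)) := by
    simp only [trace, diag, mul_apply, traceIn, of_apply, vecMulVec_apply, Pi.star_apply,
      Finset.mul_sum]
    refine Finset.sum_congr rfl fun b _ => Finset.sum_congr rfl fun c _ =>
      Finset.sum_congr rfl fun a _ => ?_
    ring
  have hr : ∀ a b, (((1 : Matrix (Bits n) (Bits n) ℂ) ⊗ₖ O) *ᵥ ψ) (a, b)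
      = ∑ c, O b c * ψ (a, c) := by
    intro a b
    simp [mulVec, dotProduct, Fintype.sum_prod_type, one_apply, Finset.sum_ite_irrel]
  rw [hl, dotProduct, Fintype.sum_prod_type]
  simp only [hr, Finset.mul_sum, Pi.star_apply]
  symm
  rw [Finset.sum_comm]
  refine Finset.sum_congr rfl fun b _ => ?_
  rw [Finset.sum_comm]

section Exp

open scoped Matrix.Norms.Operator

theorem hasDerivAt_exp_apply {ι : Type} [Fintype ι] [DecidableEq ι] (H : Matrix ι ι ℂ) (a b : ι) :
    HasDerivAt (fun ε : ℝ => (NormedSpace.exp ((Complex.I * (ε : ℂ)) • H)) a b)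
      ((Complex.I • H) a b) 0 := by
  have h := hasDerivAt_exp_smul_const (𝕂 := ℝ) (Complex.I • H) 0
  simp only [zero_smul, NormedSpace.exp_zero, one_mul] at h
  have h2 := (hasDerivAt_pi.mp ((hasDerivAt_pi.mp h) a)) b
  have e : (fun ε : ℝ => (NormedSpace.exp ((Complex.I * (ε : ℂ)) • H)) a b)
      = fun ε : ℝ => (NormedSpace.exp (ε • Complex.I • H)) a b := by
    funext ε
    rw [mul_comm, mul_smul]
    rfl
  rw [e]
  exact h2

end Exp

theorem update_zero (H V : Fin n → Matrix (PBits n) (PBits n) ℂ) : update H V 0 = V := by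
  funext j
  simp [update]

theorem hasDerivAt_update_mulVec (H V : Fin n → Matrix (PBits n) (PBits n) ℂ) (k : Fin n)
    {ψ : ℝ → NBits n → ℂ} {D : NBits n → ℂ} (hψ : HasDerivAt ψ D 0) :
    HasDerivAt (fun ε => onInputAnd k (update H V ε k) *ᵥ ψ ε)
      (onInputAnd k (Complex.I • H k) *ᵥ (onInputAnd k (V k) *ᵥ ψ 0)
        + onInputAnd k (V k) *ᵥ D) 0 := by
  rw [hasDerivAt_pi]
  intro p
  rw [mulVec_mulVec, onInputAnd_mul_onInputAnd]
  simp only [Pi.add_apply, onInputAnd_mulVec]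
  rw [← Finset.sum_add_distrib]
  refine HasDerivAt.fun_sum fun x _ => ?_
  have h1 : HasDerivAt (fun ε : ℝ => update H V ε k (site k p) x)
      (((Complex.I • H k) * V k) (site k p) x) 0 := by
    simp only [update, mul_apply]
    exact HasDerivAt.fun_sum fun c _ => (hasDerivAt_exp_apply (H k) (site k p) c).mul_const _
  have h2 := h1.mul ((hasDerivAt_pi.mp hψ) (put k x p))
  rw [update_zero] at h2
  exact h2

/-- The derivative of the evolved states at the initial time. -/
theorem exists_hasDerivAt_stateAfter (H V : Fin n → Matrix (PBits n) (PBits n) ℂ)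
    (u : NBits n → ℂ) :
    ∃ D : ℕ → NBits n → ℂ, D 0 = 0 ∧
      (∀ i ≤ n, HasDerivAt (fun ε => stateAfter (update H V ε) u i) (D i) 0) ∧
      ∀ k : Fin n, D (k + 1) = onInputAnd k (Complex.I • H k) *ᵥ stateAfter V u (k + 1)
        + onInputAnd k (V k) *ᵥ D k := by
  have step : ∀ (k : Fin n) (D : NBits n → ℂ),
      HasDerivAt (fun ε => stateAfter (update H V ε) u k) D 0 →
      HasDerivAt (fun ε => stateAfter (update H V ε) u (k + 1))
        (onInputAnd k (Complex.I • H k) *ᵥ stateAfter V u (k + 1) + onInputAnd k (V k) *ᵥ D) 0 := by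
    intro k D hD
    have h := hasDerivAt_update_mulVec H V k hD
    simp only [update_zero, ← stateAfter_succ] at h
    exact h
  have h0 : HasDerivAt (fun ε => stateAfter (update H V ε) u 0) 0 0 := by
    simp only [stateAfter_zero]
    exact hasDerivAt_const _ _
  have hd : ∀ i ≤ n, DifferentiableAt ℝ (fun ε => stateAfter (update H V ε) u i) 0 := by
    intro i
    induction i with
    | zero => exact fun _ => h0.differentiableAt
    | succ i ih =>
      intro hi
      exact (step ⟨i, hi⟩ _ (ih (by omega)).hasDerivAt).differentiableAt
  refine ⟨fun i => deriv (fun ε => stateAfter (update H V ε) u i) 0, h0.deriv,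
    fun i hi => (hd i hi).hasDerivAt, fun k => ?_⟩
  exact (step k _ (hd k k.2.le).hasDerivAt).deriv

theorem ZeroFrom.hasDerivAt {ψ : ℝ → NBits n → ℂ} {D : NBits n → ℂ} {i : ℕ}
    (hψ : HasDerivAt ψ D 0) (h : ∀ ε, ZeroFrom i (ψ ε)) : ZeroFrom i D := by
  intro p k hk hp
  have h1 := (hasDerivAt_pi.mp hψ) p
  have h2 : (fun ε => ψ ε p) = fun _ => 0 := funext fun ε => h ε p k hk hp
  rw [h2] at h1
  exact h1.unique (hasDerivAt_const _ _)

theorem hasDerivAt_expectation {m : Type*} [Fintype m] {M : Matrix m m ℂ} (hM : M.IsHermitian)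
    {ψ : ℝ → m → ℂ} {D : m → ℂ} (hψ : HasDerivAt ψ D 0) :
    HasDerivAt (fun ε => (star (ψ ε) ⬝ᵥ (M *ᵥ ψ ε)).re)
      (2 * (star (ψ 0) ⬝ᵥ (M *ᵥ D)).re) 0 := by
  have hψ' := hasDerivAt_pi.mp hψ
  have h1 : HasDerivAt (fun ε => star (ψ ε) ⬝ᵥ (M *ᵥ ψ ε))
      (star D ⬝ᵥ (M *ᵥ ψ 0) + star (ψ 0) ⬝ᵥ (M *ᵥ D)) 0 := by
    simp only [dotProduct, mulVec, ← Finset.sum_add_distrib]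
    refine HasDerivAt.fun_sum fun p _ => ?_
    refine (hψ' p).star.mul ?_
    exact HasDerivAt.fun_sum fun q _ => (hψ' q).const_mul _
  have h2 : star D ⬝ᵥ (M *ᵥ ψ 0) = star (star (ψ 0) ⬝ᵥ (M *ᵥ D)) := by
    rw [star_dotProduct, star_mulVec, hM, ← dotProduct_mulVec]
  have h3 := Complex.reCLM.hasFDerivAt.comp_hasDerivAt 0 h1
  have e : 2 * (star (ψ 0) ⬝ᵥ (M *ᵥ D)).re
      = Complex.reCLM (star D ⬝ᵥ (M *ᵥ ψ 0) + star (ψ 0) ⬝ᵥ (M *ᵥ D)) := by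
    rw [h2]
    simp
    ring
  rw [e]
  exact h3

/-- The expectation value of `M` in the final state changes at the sum of the forces of the
perceptrons, each computed from the state after that perceptron and the observable pulled back
to that time. -/
theorem hasDerivAt_expectation_stateAfter (H V : Fin n → Matrix (PBits n) (PBits n) ℂ)
    {M : Matrix (NBits n) (NBits n) ℂ} (hM : M.IsHermitian) {u : NBits n → ℂ}
    (hu : ZeroFrom 0 u) :
    HasDerivAt (fun ε => (star (stateAfter (update H V ε) u n) ⬝ᵥ
        (M *ᵥ stateAfter (update H V ε) u n)).re)
      (∑ k : Fin n, force k (H k) (heis V M k.succ) (stateAfter V u (k + 1))) 0 := by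
  obtain ⟨D, hD0, hD, hDs⟩ := exists_hasDerivAt_stateAfter H V u
  have h := hasDerivAt_expectation hM (hD n le_rfl)
  rw [update_zero] at h
  let f : Fin (n + 1) → ℝ := fun i => 2 * (star (stateAfter V u i) ⬝ᵥ (heis V M i *ᵥ D i)).re
  have hf : ∀ k : Fin n,
      f k.succ = f k.castSucc + force k (H k) (heis V M k.succ) (stateAfter V u (k + 1)) := by
    intro k
    have h1 : ZeroFrom k (stateAfter V u k) := hu.stateAfter V k k.2.le
    have h2 : ZeroFrom k (D k) :=
      ZeroFrom.hasDerivAt (hD k k.2.le) fun ε => hu.stateAfter _ k k.2.le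
    simp only [f, Fin.val_succ, Fin.val_castSucc, heis_castSucc, hDs]
    rw [star_dotProduct_pull_mulVec k _ _ (fun p hp => h1 p k le_rfl hp)
      (fun p hp => h2 p k le_rfl hp), ← stateAfter_succ, mulVec_add, dotProduct_add, force,
      Complex.add_re]
    ring
  have hsum : ∀ i : Fin (n + 1), f i = ∑ k : Fin n with k.castSucc < i,
      force k (H k) (heis V M k.succ) (stateAfter V u (k + 1)) := by
    intro i
    induction i using Fin.induction with
    | zero => simp [f, hD0]
    | succ k ih =>
      rw [hf, ih]
      have : (Finset.univ.filter fun j : Fin n => j.castSucc < k.succ)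
          = insert k (Finset.univ.filter fun j : Fin n => j.castSucc < k.castSucc) := by
        ext j
        simp [Fin.castSucc_lt_succ_iff, le_iff_eq_or_lt]
      rw [this, Finset.sum_insert (by simp), add_comm]
  have hlast := hsum (Fin.last n)
  simp only [f, heis_last, Fin.val_last, Fin.castSucc_lt_last, Finset.filter_true] at hlast
  rw [← hlast]
  exact h

/-- The derivative of the cost of one pair of training data. -/
noncomputable def drift (H V : Fin n → Matrix (PBits n) (PBits n) ℂ) (φ : Bits n → ℂ)
    (O : Matrix (Bits n) (Bits n) ℂ) : ℝ :=
  ∑ k : Fin n, force k (H k) (heis V ((1 : Matrix (Bits n) (Bits n) ℂ) ⊗ₖ O) k.succ)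
    (stateAfter V (inputState φ) (k + 1))

theorem hasDerivAt_trace_mul_outState (H V : Fin n → Matrix (PBits n) (PBits n) ℂ) (φ : Bits n → ℂ)
    {O : Matrix (Bits n) (Bits n) ℂ} (hO : O.IsHermitian) :
    HasDerivAt (fun ε => (O * outState (update H V ε) (proj φ)).trace.re) (drift H V φ O) 0 := by
  simp only [trace_mul_outState]
  refine hasDerivAt_expectation_stateAfter H V ?_ (zeroFrom_inputState φ)
  rw [IsHermitian, conjTranspose_kronecker, conjTranspose_one, hO]

theorem hasDerivAt_costAlong {N : ℕ} (φ : Fin N → Bits n → ℂ)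
    {O : Fin N → Matrix (Bits n) (Bits n) ℂ} (hO : ∀ x, (O x).IsHermitian)
    (H : Fin n → Matrix (PBits n) (PBits n) ℂ) (V : Fin n → unitaryGroup (PBits n) ℂ) :
    HasDerivAt (costAlong φ O H V)
      ((1 / (N : ℝ)) * ∑ x, drift H (fun j => (V j : Matrix (PBits n) (PBits n) ℂ)) (φ x) (O x))
      0 := by
  refine HasDerivAt.const_mul _ (HasDerivAt.fun_sum fun x _ => ?_)
  exact hasDerivAt_trace_mul_outState H _ (φ x) (hO x)

end Derivative

/-! ### Averages over the perceptrons -/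

section Averages

open scoped BigOperators ComplexOrder

variable {n : ℕ} {Y : Fin n → Type}

/-- The perceptrons as matrices, for the outcome `y` of the random draw. -/
def drawn (V : ∀ j, Y j → unitaryGroup (PBits n) ℂ) (y : ∀ j, Y j) :
    Fin n → Matrix (PBits n) (PBits n) ℂ := fun j => V j (y j)

variable {V : ∀ j, Y j → unitaryGroup (PBits n) ℂ}

theorem drawn_mem (y : ∀ j, Y j) (j : Fin n) : drawn V y j ∈ unitaryGroup (PBits n) ℂ :=
  (V j (y j)).2

theorem heis_drawn_update (M : Matrix (NBits n) (NBits n) ℂ) (y : ∀ j, Y j) {k : Fin n} (z : Y k)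
    {i : Fin (n + 1)} (h : k.castSucc < i) :
    heis (drawn V (Function.update y k z)) M i = heis (drawn V y) M i := by
  refine heis_congr M i fun j hj => ?_
  have : j ≠ k := by rintro rfl; exact absurd h (by simpa [Fin.lt_def] using hj)
  simp [drawn, this]

theorem stateAfter_drawn_update (u : NBits n → ℂ) (y : ∀ j, Y j) {k : Fin n} (z : Y k)
    {i : ℕ} (h : i ≤ k) :
    stateAfter (drawn V (Function.update y k z)) u i = stateAfter (drawn V y) u i := by
  refine stateAfter_congr u i (by omega) fun j hj => ?_
  have : j ≠ k := by rintro rfl; omega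
  simp [drawn, this]

theorem fsq_of_isHermitian {m : Type*} [Fintype m] {H : Matrix m m ℂ} (hH : H.IsHermitian) :
    fsq H = (H * H).trace.re := by
  have h := fsq_eq_trace H
  rw [hH] at h
  rw [← h, Complex.ofReal_re]

/-- The operator that measures, through `fsq (leverage * A)`, how strongly a rotation by `H` at the
perceptron `k` can change the expectation value of `A` when the state before is `u`. -/
noncomputable def leverage (k : Fin n) (H : Matrix (PBits n) (PBits n) ℂ) (u : NBits n → ℂ) :
    Matrix (PBits n × PBits n) (NBits n) ℂ :=
  (H ⊗ₖ (1 : Matrix (PBits n) (PBits n) ℂ)) * slotMatrix k u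

theorem leverage_apply_eq_zero (k : Fin n) (H : Matrix (PBits n) (PBits n) ℂ) {u : NBits n → ℂ}
    (hu : ZeroFrom k u) (x : PBits n × PBits n) {t : NBits n} {j : Fin n} (hj : k < j)
    (ht : t.2 j ≠ 0) : leverage k H u x t = 0 := by
  obtain ⟨a, i⟩ := x
  rw [leverage, kronecker_mul_slotMatrix_apply,
    hu (put k i t) j hj.le (by simpa [put, hj.ne'] using ht)]
  simp

theorem fsq_leverage_stateAfter (k : Fin n) (H : Matrix (PBits n) (PBits n) ℂ) {φ : Bits n → ℂ}
    (hφ : IsState φ) (y : ∀ j, Y j) :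
    fsq (leverage k H (stateAfter (drawn V y) (inputState φ) k)) = fsq H := by
  rw [leverage, fsq_kronecker_mul_slotMatrix, sum_norm_sq_stateAfter (drawn_mem y) _ k k.2.le,
    sum_norm_sq_inputState hφ, mul_one]

variable [∀ j, Fintype (Y j)]

theorem average_eq_expect (F : (∀ j, Y j) → ℝ) : average F = 𝔼 y, F y := by
  rw [average, Fintype.expect_eq_sum_div_card]; ring

/-- Drawing the perceptron `k` a second time does not change an average. -/
theorem expect_resample {E : Type*} [AddCommGroup E] [Module ℚ≥0 E] (k : Fin n) [Nonempty (Y k)]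
    (F : (∀ j, Y j) → E) : 𝔼 y, F y = 𝔼 y, 𝔼 z : Y k, F (Function.update y k z) := by
  rw [← Finset.expect_product' Finset.univ Finset.univ
    fun (y : ∀ j, Y j) (z : Y k) => F (Function.update y k z), Finset.univ_product_univ]
  -- exchanging the old and the new perceptron is a bijection
  let e : (∀ j, Y j) × Y k ≃ (∀ j, Y j) × Y k :=
    { toFun := fun x => (Function.update x.1 k x.2, x.1 k)
      invFun := fun x => (Function.update x.1 k x.2, x.1 k)
      left_inv := fun x => by simp
      right_inv := fun x => by simp }
  refine Eq.trans ?_ (Fintype.expect_equiv e _ (fun x => F x.1) fun x => rfl).symm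
  rw [← Finset.univ_product_univ,
    Finset.expect_product' Finset.univ Finset.univ fun (y : ∀ j, Y j) (_ : Y k) => F y]
  simp only [Fintype.expect_const]

/-- The mean square of the force on the perceptron `k`. The shift `c` is arbitrary and may be
random. -/
theorem expect_force_sq_le (hV : ∀ j, IsUnitaryDesign 2 (V j)) (k : Fin n)
    {H : Matrix (PBits n) (PBits n) ℂ} (hH : H.IsHermitian)
    {M : Matrix (NBits n) (NBits n) ℂ} (hM : M.PosSemidef) (c : (∀ j, Y j) → ℝ)
    {φ : Bits n → ℂ} (hφ : IsState φ) :
    𝔼 y, force k H (heis (drawn V y) M k.succ) (stateAfter (drawn V y) (inputState φ) (k + 1)) ^ 2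
      ≤ 4 / ((2 ^ (n + 1) : ℝ) ^ 2 - 1) * 𝔼 y,
        fsq (leverage k H (stateAfter (drawn V y) (inputState φ) k)
          * (heis (drawn V y) M k.succ - (c y : ℂ) • 1)) := by
  have := (hV k).nonempty
  rw [expect_resample k, Finset.mul_expect]
  refine Finset.expect_le_expect fun y _ => ?_
  have h := (hV k).expect_force_sq_le k hH (heis_posSemidef (drawn V y) hM k.succ).1 (c y)
    (stateAfter (drawn V y) (inputState φ) k)
  rw [sum_norm_sq_stateAfter (drawn_mem y) _ k k.2.le, sum_norm_sq_inputState hφ, mul_one] at h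
  refine le_of_eq_of_le ?_ h
  refine Finset.expect_congr rfl fun z _ => ?_
  rw [stateAfter_succ, heis_drawn_update M y z (Fin.castSucc_lt_succ),
    stateAfter_drawn_update _ y z le_rfl]
  simp [drawn]

theorem fsq_mul_of_isHermitian {m l : Type*} [Fintype m] [Fintype l] (W : Matrix l m ℂ)
    {A : Matrix m m ℂ} (hA : A.IsHermitian) : fsq (W * A) = (W * (A * A) * Wᴴ).trace.re := by
  have h := fsq_eq_trace (W * A)
  rw [conjTranspose_mul, hA] at h
  have h2 : W * A * (A * Wᴴ) = W * (A * A) * Wᴴ := by simp only [Matrix.mul_assoc]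
  rw [← h2, ← h, Complex.ofReal_re]

theorem trace_re_nonneg_of_posSemidef {m l : Type*} [Fintype m] [Fintype l] (W : Matrix l m ℂ)
    {A : Matrix m m ℂ} (hA : A.PosSemidef) : 0 ≤ (W * A * Wᴴ).trace.re :=
  (Complex.le_def.mp (hA.mul_mul_conjTranspose_same W).trace_nonneg).1

theorem fsq_mul_le_trace {m l : Type*} [Fintype m] [DecidableEq m] [Fintype l] (W : Matrix l m ℂ)
    {A : Matrix m m ℂ} (hA : A.PosSemidef) (hA' : (1 - A).PosSemidef) :
    fsq (W * A) ≤ (W * A * Wᴴ).trace.re := by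
  have h : A - A * A = Aᴴ * (1 - A) * A + (1 - A)ᴴ * A * (1 - A) := by
    rw [hA.1, hA'.1]; noncomm_ring
  have h1 : (A - A * A).PosSemidef := by
    rw [h]
    exact (hA'.conjTranspose_mul_mul_same _).add (hA.conjTranspose_mul_mul_same _)
  have h2 := trace_re_nonneg_of_posSemidef W h1
  rw [Matrix.mul_sub, Matrix.sub_mul, trace_sub, Complex.sub_re] at h2
  rw [fsq_mul_of_isHermitian W hA.1]
  linarith

theorem fsq_mul_le {m l : Type*} [Fintype m] [DecidableEq m] [Fintype l] (W : Matrix l m ℂ)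
    {A : Matrix m m ℂ} (hA : A.PosSemidef) (hA' : (1 - A).PosSemidef) : fsq (W * A) ≤ fsq W := by
  refine (fsq_mul_le_trace W hA hA').trans ?_
  have h2 := trace_re_nonneg_of_posSemidef W hA'
  rw [Matrix.mul_sub, Matrix.sub_mul, trace_sub, Complex.sub_re, Matrix.mul_one, ← fsq_eq_trace,
    Complex.ofReal_re] at h2
  linarith

theorem sum_pow_sub_eq (a : ℝ) (j : Fin n) :
    ∑ k : Fin n with k ≤ j, a ^ ((j : ℕ) - k) = ∑ m ∈ Finset.range (j + 1), a ^ m := by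
  refine Finset.sum_nbij' (fun k => (j : ℕ) - k) (fun m => ⟨j - m, by omega⟩) ?_ ?_ ?_ ?_ ?_
  · intro k _
    exact Finset.mem_range.mpr (by omega)
  · intro m _
    exact Finset.mem_filter.mpr ⟨Finset.mem_univ _, Fin.le_def.mpr (Nat.sub_le _ _)⟩
  · intro k hk
    have : k ≤ j := by simpa using hk
    rw [Fin.le_def] at this
    ext; simp; omega
  · intro m hm
    have : m < j + 1 := Finset.mem_range.mp hm
    simp only
    omega
  · intro k hk; rfl

/-- A sum of random variables whose mean squares decay geometrically away from the index `j`. -/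
theorem expect_sum_sq_le {Ω : Type*} [Fintype Ω] (X : Fin n → Ω → ℝ) (j : Fin n) {C : ℝ}
    (h0 : ∀ k, j < k → ∀ y, X k y = 0)
    (h1 : ∀ k, k ≤ j → 𝔼 y, X k y ^ 2 ≤ C * (1 / 2) ^ ((j : ℕ) - k)) :
    𝔼 y, (∑ k, X k y) ^ 2 ≤ 12 * C := by
  have hC : 0 ≤ C := by
    have := h1 j le_rfl
    have h2 : 0 ≤ 𝔼 y, X j y ^ 2 := Finset.expect_nonneg fun y _ => sq_nonneg _
    simpa using h2.trans this
  -- Cauchy-Schwarz with the weights `(2 / 3) ^ (j - k)`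
  have hcs : ∀ y, (∑ k, X k y) ^ 2
      ≤ 3 * ∑ k : Fin n with k ≤ j, (3 / 2) ^ ((j : ℕ) - k) * X k y ^ 2 := by
    intro y
    have hs : ∑ k, X k y = ∑ k : Fin n with k ≤ j, X k y := by
      rw [Finset.sum_filter]
      refine Finset.sum_congr rfl fun k _ => ?_
      split_ifs with h
      · rfl
      · exact h0 k (not_le.mp h) y
    rw [hs]
    refine (Finset.sum_sq_le_sum_mul_sum_of_sq_le_mul _
      (f := fun k : Fin n => (2 / 3 : ℝ) ^ ((j : ℕ) - k))
      (g := fun k => (3 / 2) ^ ((j : ℕ) - k) * X k y ^ 2) (fun k _ => by positivity)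
      (fun k _ => by positivity) fun k _ => ?_).trans ?_
    · rw [← mul_assoc, ← mul_pow]; norm_num
    · gcongr
      rw [sum_pow_sub_eq, geom_sum_eq (by norm_num)]
      have : (0 : ℝ) < (2 / 3) ^ ((j : ℕ) + 1) := by positivity
      rw [div_le_iff_of_neg (by norm_num)]
      linarith
  calc 𝔼 y, (∑ k, X k y) ^ 2
      ≤ 𝔼 y, 3 * ∑ k : Fin n with k ≤ j, (3 / 2) ^ ((j : ℕ) - k) * X k y ^ 2 :=
        Finset.expect_le_expect fun y _ => hcs y
    _ = 3 * ∑ k : Fin n with k ≤ j, (3 / 2) ^ ((j : ℕ) - k) * 𝔼 y, X k y ^ 2 := by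
        rw [← Finset.mul_expect, Finset.expect_sum_comm]
        simp only [← Finset.mul_expect]
    _ ≤ 3 * ∑ k : Fin n with k ≤ j, C * (3 / 4) ^ ((j : ℕ) - k) := by
        refine mul_le_mul_of_nonneg_left (Finset.sum_le_sum fun k hk => ?_) (by norm_num)
        refine (mul_le_mul_of_nonneg_left (h1 k (by simpa using hk)) (by positivity)).trans_eq ?_
        rw [mul_left_comm, ← mul_pow]; norm_num
    _ ≤ 12 * C := by
        rw [← Finset.mul_sum, sum_pow_sub_eq, geom_sum_eq (by norm_num)]
        have : (0 : ℝ) < (3 / 4) ^ ((j : ℕ) + 1) := by positivity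
        have h3 : ((3 / 4 : ℝ) ^ ((j : ℕ) + 1) - 1) / (3 / 4 - 1) ≤ 4 := by
          rw [div_le_iff_of_neg (by norm_num)]
          linarith
        nlinarith

end Averages

/-! ### The global cost -/

section Global

open scoped BigOperators ComplexOrder

variable {n : ℕ}

/-- The completely depolarizing channel on the output qubit `j`. -/
noncomputable def depolarize (j : Fin n) (P : Matrix (Bits n) (Bits n) ℂ) :
    Matrix (Bits n) (Bits n) ℂ :=
  of fun b c => if b j = c j then
    (∑ e, P (Function.update b j e) (Function.update c j e)) / 2 else 0

theorem card_pBits (n : ℕ) : (Fintype.card (PBits n) : ℂ) = 2 ^ n * 2 := by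
  simp [PBits, Bits]

/-- On average over a `2`-design for the perceptron `k`, pulling back replaces an observable by the
normalized partial trace over the input layer and the output qubit `k`. -/
theorem IsUnitaryDesign.expect_pull_apply (k : Fin n) {Y : Type} [Fintype Y]
    {V : Y → unitaryGroup (PBits n) ℂ} (hV : IsUnitaryDesign 2 V)
    (M : Matrix (NBits n) (NBits n) ℂ) (p q : NBits n) :
    𝔼 z, pull k (V z : Matrix (PBits n) (PBits n) ℂ) M p q
      = if p.1 = q.1 ∧ p.2 k = q.2 k then
          (∑ x, M (put k x p) (put k x q)) / (2 ^ n * 2) else 0 := by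
  by_cases h : p.2 k = q.2 k
  · have := hV.expect_conj (block k M p q) (p.1, 0) (q.1, 0)
    have hp : ∀ z, pull k (V z : Matrix (PBits n) (PBits n) ℂ) M p q
        = ((V z : Matrix (PBits n) (PBits n) ℂ)ᴴ * block k M p q * V z) (p.1, 0) (q.1, 0) :=
      fun z => if_pos h
    simp only [hp, this, card_pBits, Prod.mk.injEq, and_true]
    simp only [h, and_true]
    rfl
  · simp [pull, h]

theorem sum_one_kronecker_put (k : Fin n) (P : Matrix (Bits n) (Bits n) ℂ) (p q : NBits n) :
    ∑ x, ((1 : Matrix (Bits n) (Bits n) ℂ) ⊗ₖ P) (put k x p) (put k x q)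
      = 2 ^ n * ∑ e, P (Function.update p.2 k e) (Function.update q.2 k e) := by
  rw [Fintype.sum_prod_type]
  simp [put]
  ring

/-- The observable `P` of the output layer, with the output qubits from number `i` on
depolarized. -/
noncomputable def depolarizeFrom (P : Matrix (Bits n) (Bits n) ℂ) (i : Fin (n + 1)) :
    Matrix (Bits n) (Bits n) ℂ :=
  Fin.reverseInduction (motive := fun _ => Matrix (Bits n) (Bits n) ℂ) P
    (fun k Q => depolarize k Q) i

theorem depolarizeFrom_last (P : Matrix (Bits n) (Bits n) ℂ) :
    depolarizeFrom P (Fin.last n) = P := by simp [depolarizeFrom]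

theorem depolarizeFrom_castSucc (P : Matrix (Bits n) (Bits n) ℂ) (k : Fin n) :
    depolarizeFrom P k.castSucc = depolarize k (depolarizeFrom P k.succ) := by
  simp [depolarizeFrom]

/-- The average of a pulled back observable, also against a weight `g` that depends on the
earlier perceptrons only. -/
theorem expect_mul_heis_apply {Y : Fin n → Type} [∀ j, Fintype (Y j)]
    {V : ∀ j, Y j → unitaryGroup (PBits n) ℂ} (hV : ∀ j, IsUnitaryDesign 2 (V j))
    (P : Matrix (Bits n) (Bits n) ℂ) (g : (∀ j, Y j) → ℂ) (i : Fin (n + 1)) :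
    (∀ (j : Fin n), i ≤ j.castSucc → ∀ y z, g (Function.update y j z) = g y) → ∀ p q,
      𝔼 y, g y * heis (drawn V y) ((1 : Matrix (Bits n) (Bits n) ℂ) ⊗ₖ P) i p q
        = (𝔼 y, g y) * ((1 : Matrix (Bits n) (Bits n) ℂ) ⊗ₖ depolarizeFrom P i) p q := by
  induction i using Fin.reverseInduction with
  | last =>
    intro _ p q
    simp only [heis_last, depolarizeFrom_last, ← Finset.expect_mul]
  | cast k ih =>
    intro hg p q
    have := (hV k).nonempty
    have ih' := ih fun j hj => hg j ((Fin.castSucc_lt_succ.trans_le hj).le)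
    rw [expect_resample k]
    have h1 : ∀ y, 𝔼 z : Y k, g (Function.update y k z)
          * heis (drawn V (Function.update y k z)) (1 ⊗ₖ P) k.castSucc p q
        = if p.1 = q.1 ∧ p.2 k = q.2 k then
            (∑ x, g y * heis (drawn V y) (1 ⊗ₖ P) k.succ (put k x p) (put k x q)) / (2 ^ n * 2)
          else 0 := by
      intro y
      have h2 := (hV k).expect_pull_apply k (heis (drawn V y) (1 ⊗ₖ P) k.succ) p q
      simp only [hg k le_rfl, heis_castSucc, heis_drawn_update _ y _ (Fin.castSucc_lt_succ),
        ← Finset.mul_expect]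
      simp only [drawn, Function.update_self]
      rw [h2, mul_ite, mul_zero, mul_div_assoc', Finset.mul_sum]
    by_cases h : p.1 = q.1 ∧ p.2 k = q.2 k
    · simp only [fun y => (h1 y).trans (if_pos h)]
      simp only [← Finset.expect_div, Finset.expect_sum_comm, ih']
      rw [← Finset.mul_sum, sum_one_kronecker_put]
      simp only [depolarizeFrom_castSucc, kroneckerMap_apply, depolarize, of_apply]
      rw [if_pos h.2, h.1, one_apply_eq]
      field_simp
    · simp only [h1, if_neg h, Finset.expect_const_zero, depolarizeFrom_castSucc,
        kroneckerMap_apply, depolarize, of_apply, one_apply]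
      rw [not_and_or] at h
      rcases h with h | h <;> simp [h]

theorem depolarize_posSemidef (j : Fin n) {P : Matrix (Bits n) (Bits n) ℂ} (hP : P.PosSemidef) :
    (depolarize j P).PosSemidef := by
  -- the Kraus form: `E e f` takes the qubit from `f` to `e`
  let E : Fin 2 → Fin 2 → Matrix (Bits n) (Bits n) ℂ := fun e f =>
    of fun s c => if c j = f ∧ s = Function.update c j e then 1 else 0
  have h : depolarize j P = (1 / 2 : ℝ) • ∑ e, ∑ f, (E e f)ᴴ * P * E e f := by
    ext b c
    have h1 : ∀ e f, ((E e f)ᴴ * P * E e f) b c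
        = if c j = f ∧ b j = f then P (Function.update b j e) (Function.update c j e) else 0 := by
      intro e f
      by_cases hc : c j = f <;> by_cases hb : b j = f <;>
        simp [mul_apply, E, hb, hc, apply_ite (starRingEnd ℂ)]
    have h2 : ∀ e, ∑ f, (if c j = f ∧ b j = f then
        P (Function.update b j e) (Function.update c j e) else 0)
        = if b j = c j then P (Function.update b j e) (Function.update c j e) else 0 := by
      intro e
      simp [ite_and]
    rw [Matrix.smul_apply]
    simp only [Matrix.sum_apply, h1, h2, depolarize, of_apply]
    by_cases hbc : b j = c j
    · simp only [if_pos hbc, Complex.real_smul]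
      push_cast
      ring
    · simp [hbc]
  rw [h]
  exact (posSemidef_sum _ fun e _ => posSemidef_sum _ fun f _ =>
    hP.conjTranspose_mul_mul_same _).smul (by norm_num)

theorem depolarizeFrom_posSemidef {P : Matrix (Bits n) (Bits n) ℂ} (hP : P.PosSemidef)
    (i : Fin (n + 1)) : (depolarizeFrom P i).PosSemidef := by
  induction i using Fin.reverseInduction with
  | last => rwa [depolarizeFrom_last]
  | cast k ih => rw [depolarizeFrom_castSucc]; exact depolarize_posSemidef _ ih

/-- The trace of the block of `P` in which the output qubits from number `i` on are `0`. -/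
def zeroTrace (i : ℕ) (P : Matrix (Bits n) (Bits n) ℂ) : ℂ :=
  ∑ b, if ∀ j : Fin n, i ≤ j → b j = 0 then P b b else 0

theorem sum_update {E : Type*} [AddCommMonoid E] (k : Fin n) (F : Bits n → E) :
    ∑ b : Bits n, (if b k = 0 then ∑ e, F (Function.update b k e) else 0) = ∑ b, F b := by
  rw [← Finset.sum_filter, ← Finset.sum_product']
  refine Finset.sum_nbij' (fun x => Function.update x.1 k x.2)
    (fun b => (Function.update b k 0, b k)) ?_ ?_ ?_ ?_ ?_
  · simp
  · simp
  · rintro ⟨b, e⟩ h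
    have : b k = 0 := by simpa using h
    simp [← this]
  · simp
  · simp

theorem zeroTrace_depolarize (k : Fin n) (P : Matrix (Bits n) (Bits n) ℂ) :
    zeroTrace k (depolarize k P) = zeroTrace (k + 1) P / 2 := by
  unfold zeroTrace
  rw [← sum_update k fun b => if ∀ j : Fin n, (k : ℕ) + 1 ≤ j → b j = 0 then P b b else 0,
    Finset.sum_div]
  refine Finset.sum_congr rfl fun b _ => ?_
  have h1 : (∀ j : Fin n, (k : ℕ) ≤ j → b j = 0) ↔
      b k = 0 ∧ ∀ j : Fin n, (k : ℕ) + 1 ≤ j → b j = 0 := by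
    constructor
    · exact fun h => ⟨h k le_rfl, fun j hj => h j (by omega)⟩
    · rintro ⟨h0, h⟩ j hj
      rcases hj.eq_or_lt with h2 | h2
      · rwa [← Fin.ext h2]
      · exact h j h2
  have h2 : ∀ e, (∀ j : Fin n, (k : ℕ) + 1 ≤ j → Function.update b k e j = 0) ↔
      ∀ j : Fin n, (k : ℕ) + 1 ≤ j → b j = 0 := by
    intro e
    refine forall_congr' fun j => forall_congr' fun hj => ?_
    have : j ≠ k := by rintro rfl; omega
    simp [this]
  simp only [h1, h2, depolarize, of_apply]
  by_cases h3 : b k = 0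
  · by_cases h4 : ∀ j : Fin n, (k : ℕ) + 1 ≤ j → b j = 0
    · simp only [h3, if_true, if_pos h4, true_and]
    · simp only [h3, if_neg h4, true_and, Finset.sum_const_zero, ite_self, zero_div]
  · simp [h3]

theorem zeroTrace_depolarizeFrom (P : Matrix (Bits n) (Bits n) ℂ) (i : Fin (n + 1)) :
    zeroTrace i (depolarizeFrom P i) = P.trace * (1 / 2) ^ (n - (i : ℕ)) := by
  induction i using Fin.reverseInduction with
  | last =>
    simp only [zeroTrace, depolarizeFrom_last, Fin.val_last, Nat.sub_self, pow_zero, mul_one]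
    refine Finset.sum_congr rfl fun b _ => ?_
    rw [if_pos fun j hj => absurd j.2 (by omega)]
    rfl
  | cast k ih =>
    rw [depolarizeFrom_castSucc, Fin.val_castSucc, zeroTrace_depolarize]
    rw [Fin.val_succ] at ih
    rw [ih, show n - (k : ℕ) = n - (k + 1) + 1 by omega, pow_succ]
    ring

section Factorization

open scoped MatrixOrder Matrix.Norms.L2Operator

theorem _root_.Matrix.PosSemidef.exists_eq_conjTranspose_mul_self {m : Type*} [Fintype m]
    [DecidableEq m] {P : Matrix m m ℂ} (hP : P.PosSemidef) : ∃ B : Matrix m m ℂ, P = Bᴴ * B :=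
  CStarAlgebra.nonneg_iff_eq_star_mul_self.mp hP.nonneg

end Factorization

theorem posSemidef_form_le {m : Type*} [Fintype m] [DecidableEq m] {P : Matrix m m ℂ}
    (hP : P.PosSemidef) (S : m → Prop) [DecidablePred S] (w : m → ℂ) (hw : ∀ b, ¬ S b → w b = 0) :
    (star w ⬝ᵥ (P *ᵥ w)).re ≤ (∑ b, ‖w b‖ ^ 2) * (∑ b, if S b then P b b else 0).re := by
  obtain ⟨B, rfl⟩ := hP.exists_eq_conjTranspose_mul_self
  have h1 : star w ⬝ᵥ ((Bᴴ * B) *ᵥ w) = ((∑ r, ‖(B *ᵥ w) r‖ ^ 2 : ℝ) : ℂ) := by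
    rw [sum_norm_sq_eq, star_mulVec, ← dotProduct_mulVec, mulVec_mulVec]
  have h2 : (∑ b, if S b then (Bᴴ * B) b b else 0)
      = ((∑ b, ∑ r, if S b then ‖B r b‖ ^ 2 else 0 : ℝ) : ℂ) := by
    push_cast
    refine Finset.sum_congr rfl fun b _ => ?_
    split_ifs
    · simp [mul_apply, Complex.conj_mul']
    · simp
  rw [h1, h2, Complex.ofReal_re, Complex.ofReal_re, Finset.sum_comm, Finset.mul_sum]
  refine Finset.sum_le_sum fun r _ => ?_
  have h3 : ‖(B *ᵥ w) r‖ ≤ ∑ b, (‖w b‖ * if S b then ‖B r b‖ else 0) := by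
    refine (norm_sum_le _ _).trans (Finset.sum_le_sum fun b _ => ?_)
    by_cases hb : S b
    · simp [hb, mul_comm]
    · simp [hb, hw b hb]
  calc ‖(B *ᵥ w) r‖ ^ 2 ≤ (∑ b, (‖w b‖ * if S b then ‖B r b‖ else 0)) ^ 2 := by gcongr
    _ ≤ _ := Finset.sum_mul_sq_le_sq_mul_sq _ _ _
    _ = _ := by simp [ite_pow]

/-- The depolarized observable in states whose later output qubits are `0`. -/
theorem trace_mul_depolarizeFrom_le {l : Type*} [Fintype l] {P : Matrix (Bits n) (Bits n) ℂ}
    (hP : P.PosSemidef) (htr : P.trace = 1) (i : Fin (n + 1)) (W : Matrix l (NBits n) ℂ)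
    (hW : ∀ x (t : NBits n) (j : Fin n), (i : ℕ) ≤ j → t.2 j ≠ 0 → W x t = 0) :
    (W * ((1 : Matrix (Bits n) (Bits n) ℂ) ⊗ₖ depolarizeFrom P i) * Wᴴ).trace.re
      ≤ fsq W * (1 / 2) ^ (n - (i : ℕ)) := by
  set Q := depolarizeFrom P i with hQ
  have h1 : (W * ((1 : Matrix (Bits n) (Bits n) ℂ) ⊗ₖ Q) * Wᴴ).trace
      = ∑ x, ∑ a, star (fun b => star (W x (a, b))) ⬝ᵥ (Q *ᵥ fun b => star (W x (a, b))) := by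
    simp only [trace, diag, mul_apply, Fintype.sum_prod_type, kroneckerMap_apply, one_apply,
      conjTranspose_apply, dotProduct, mulVec, Pi.star_apply, star_star, Finset.mul_sum,
      Finset.sum_mul]
    refine Finset.sum_congr rfl fun x _ => Finset.sum_congr rfl fun a _ => ?_
    refine Eq.trans ?_ Finset.sum_comm
    refine Finset.sum_congr rfl fun b _ => ?_
    rw [Finset.sum_comm]
    refine Finset.sum_congr rfl fun c _ => ?_
    simp [mul_assoc]
  have hz : (∑ b, if ∀ j : Fin n, (i : ℕ) ≤ j → b j = 0 then Q b b else 0).re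
      = (1 / 2) ^ (n - (i : ℕ)) := by
    have := zeroTrace_depolarizeFrom P i
    rw [htr, one_mul, zeroTrace] at this
    rw [this]
    have h2 : ((1 / 2 : ℂ)) ^ (n - (i : ℕ)) = (((1 / 2 : ℝ) ^ (n - (i : ℕ)) : ℝ) : ℂ) := by
      push_cast; rfl
    rw [h2, Complex.ofReal_re]
  rw [h1, Complex.re_sum, fsq, Finset.sum_mul]
  refine Finset.sum_le_sum fun x _ => ?_
  rw [Complex.re_sum, Fintype.sum_prod_type, Finset.sum_mul]
  refine Finset.sum_le_sum fun a _ => ?_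
  have := posSemidef_form_le (depolarizeFrom_posSemidef hP i)
    (fun b => ∀ j : Fin n, (i : ℕ) ≤ j → b j = 0) (fun b => star (W x (a, b))) (by
      intro b hb
      push Not at hb
      obtain ⟨j, hj, hbj⟩ := hb
      simp [hW x (a, b) j hj hbj])
  rw [← hQ, hz] at this
  simpa using this

/-- Replacing a random observable by its average. -/
theorem expect_trace_mul_heis {Y : Fin n → Type} [∀ j, Fintype (Y j)]
    {V : ∀ j, Y j → unitaryGroup (PBits n) ℂ} (hV : ∀ j, IsUnitaryDesign 2 (V j))
    (P : Matrix (Bits n) (Bits n) ℂ) (i : Fin (n + 1)) {l : Type*} [Fintype l]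
    (W : (∀ j, Y j) → Matrix l (NBits n) ℂ)
    (hW : ∀ (j : Fin n), i ≤ j.castSucc → ∀ y z, W (Function.update y j z) = W y) :
    𝔼 y, (W y * heis (drawn V y) ((1 : Matrix (Bits n) (Bits n) ℂ) ⊗ₖ P) i * (W y)ᴴ).trace.re
      = 𝔼 y, (W y * ((1 : Matrix (Bits n) (Bits n) ℂ) ⊗ₖ depolarizeFrom P i)
        * (W y)ᴴ).trace.re := by
  have key : ∀ Z : (∀ j, Y j) → Matrix (NBits n) (NBits n) ℂ, ∀ y,
      (W y * Z y * (W y)ᴴ).trace = ∑ x, ∑ t, ∑ s, (W y x s * star (W y x t)) * Z y s t := by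
    intro Z y
    simp only [trace, diag, mul_apply, conjTranspose_apply, Finset.sum_mul]
    refine Finset.sum_congr rfl fun x _ => Finset.sum_congr rfl fun t _ =>
      Finset.sum_congr rfl fun s _ => ?_
    ring
  have hre : ∀ f : (∀ j, Y j) → ℂ, 𝔼 y, (f y).re = (𝔼 y, f y).re := by
    intro f
    rw [Fintype.expect_eq_sum_div_card, Fintype.expect_eq_sum_div_card, Complex.div_natCast_re,
      Complex.re_sum]
  rw [hre, hre]
  refine congrArg Complex.re ?_
  rw [Finset.expect_congr rfl fun y _ => key
      (fun y => heis (drawn V y) ((1 : Matrix (Bits n) (Bits n) ℂ) ⊗ₖ P) i) y,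
    Finset.expect_congr rfl fun y _ => key
      (fun _ => (1 : Matrix (Bits n) (Bits n) ℂ) ⊗ₖ depolarizeFrom P i) y]
  simp only [Finset.expect_sum_comm]
  refine Finset.sum_congr rfl fun x _ => Finset.sum_congr rfl fun t _ =>
    Finset.sum_congr rfl fun s _ => ?_
  rw [expect_mul_heis_apply hV P (fun y => W y x s * star (W y x t)) i
    (fun j hj y z => by simp only [hW j hj]), Finset.expect_mul]

theorem proj_mul_proj {ι : Type} [Fintype ι] {ψ : ι → ℂ} (hψ : IsState ψ) :
    proj ψ * proj ψ = proj ψ := by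
  have h : star ψ ⬝ᵥ ψ = 1 := by
    rw [← sum_norm_sq_eq]; simp [show ∑ i, ‖ψ i‖ ^ 2 = 1 from hψ]
  rw [proj, vecMulVec_mul_vecMulVec, h]
  simp

theorem proj_isHermitian {ι : Type} (ψ : ι → ℂ) : (proj ψ).IsHermitian := by
  rw [proj, IsHermitian, conjTranspose_vecMulVec, star_star]

theorem trace_proj {ι : Type} [Fintype ι] {ψ : ι → ℂ} (hψ : IsState ψ) : (proj ψ).trace = 1 := by
  rw [proj, trace_vecMulVec, dotProduct_comm, ← sum_norm_sq_eq]
  simp [show ∑ i, ‖ψ i‖ ^ 2 = 1 from hψ]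

theorem posSemidef_of_projection {m : Type*} [Fintype m] {A : Matrix m m ℂ}
    (h1 : A.IsHermitian) (h2 : A * A = A) : A.PosSemidef := by
  have := posSemidef_conjTranspose_mul_self A
  rwa [h1, h2] at this

theorem one_sub_posSemidef_of_projection {m : Type*} [Fintype m] [DecidableEq m] {A : Matrix m m ℂ}
    (h1 : A.IsHermitian) (h2 : A * A = A) : (1 - A).PosSemidef := by
  refine posSemidef_of_projection ?_ ?_
  · rw [IsHermitian, conjTranspose_sub, h1, conjTranspose_one]
  · rw [sub_mul, mul_sub, mul_sub, h2]; simp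

/-- The mean square force for the global projector: the later perceptrons depolarize their output
qubits, each of which halves the force. -/
theorem expect_force_global_sq_le {Y : Fin n → Type} [∀ j, Fintype (Y j)]
    {V : ∀ j, Y j → unitaryGroup (PBits n) ℂ} (hV : ∀ j, IsUnitaryDesign 2 (V j)) (k : Fin n)
    {H : Matrix (PBits n) (PBits n) ℂ} (hH : H.IsHermitian) (hH2 : fsq H ≤ 2 ^ (n + 1))
    {φ χ : Bits n → ℂ} (hφ : IsState φ) (hχ : IsState χ) :
    𝔼 y, force k H (heis (drawn V y) ((1 : Matrix (Bits n) (Bits n) ℂ) ⊗ₖ proj χ) k.succ)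
        (stateAfter (drawn V y) (inputState φ) (k + 1)) ^ 2
      ≤ 4 / ((2 ^ (n + 1) : ℝ) ^ 2 - 1) * 2 ^ (n + 1) * (1 / 2) ^ (n - 1 - (k : ℕ)) := by
  set M := (1 : Matrix (Bits n) (Bits n) ℂ) ⊗ₖ proj χ with hM
  have hMh : M.IsHermitian := by
    rw [hM, IsHermitian, conjTranspose_kronecker, conjTranspose_one, proj_isHermitian]
  have hMM : M * M = M := by rw [hM, ← mul_kronecker_mul, one_mul, proj_mul_proj hχ]
  have hM1 := posSemidef_of_projection hMh hMM
  have hM2 := one_sub_posSemidef_of_projection hMh hMM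
  refine (expect_force_sq_le hV k hH hM1 (fun _ => 0) hφ).trans ?_
  have h0 : (1 : ℝ) < 2 ^ (n + 1) := one_lt_pow₀ (by norm_num) (by omega)
  have hC : 0 ≤ 4 / ((2 ^ (n + 1) : ℝ) ^ 2 - 1) := by
    apply div_nonneg <;> nlinarith
  rw [mul_assoc]
  refine mul_le_mul_of_nonneg_left ?_ hC
  set W := fun y => leverage k H (stateAfter (drawn V y) (inputState φ) k) with hW
  calc _ ≤ 𝔼 y, (W y * heis (drawn V y) M k.succ * (W y)ᴴ).trace.re := by
        refine Finset.expect_le_expect fun y _ => ?_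
        rw [Complex.ofReal_zero, zero_smul, sub_zero]
        refine fsq_mul_le_trace _ (heis_posSemidef _ hM1 _) ?_
        rw [← heis_one_sub (drawn_mem y)]
        exact heis_posSemidef _ hM2 _
    _ = 𝔼 y, (W y * ((1 : Matrix (Bits n) (Bits n) ℂ) ⊗ₖ depolarizeFrom (proj χ) k.succ)
          * (W y)ᴴ).trace.re := by
        refine expect_trace_mul_heis hV _ _ W fun j hj y z => ?_
        have : (k : ℕ) ≤ j := by
          have := Fin.le_def.mp hj
          simp at this; omega
        simp only [hW, stateAfter_drawn_update _ y z this]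
    _ ≤ 𝔼 y : ∀ j, Y j, (2 : ℝ) ^ (n + 1) * (1 / 2) ^ (n - 1 - (k : ℕ)) := by
        refine Finset.expect_le_expect fun y _ => ?_
        refine (trace_mul_depolarizeFrom_le (posSemidef_of_projection (proj_isHermitian χ)
          (proj_mul_proj hχ)) (trace_proj hχ) k.succ (W y) fun x t j hj ht => ?_).trans ?_
        · exact leverage_apply_eq_zero k H
            ((zeroFrom_inputState φ).stateAfter _ k k.2.le) x
            (Fin.lt_def.mpr (by simpa using hj)) ht
        · rw [show n - (k.succ : ℕ) = n - 1 - k by simp; omega]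
          gcongr
          exact (fsq_leverage_stateAfter k H hφ y).trans_le hH2
    _ = _ := by
        have : ∀ j, Nonempty (Y j) := fun j => (hV j).nonempty
        rw [Fintype.expect_const]

end Global

/-! ### The local cost -/

section Local

open scoped BigOperators ComplexOrder

variable {n : ℕ}

theorem one_kronecker_onOutput (j : Fin n) (W : Matrix (Fin 2) (Fin 2) ℂ) :
    (1 : Matrix (Bits n) (Bits n) ℂ) ⊗ₖ onOutput j W
      = onInputAnd j ((1 : Matrix (Bits n) (Bits n) ℂ) ⊗ₖ W) := by
  ext p q
  simp only [kroneckerMap_apply, onOutput, onInputAnd, of_apply, mul_ite, mul_zero]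

theorem kronecker_one_eq_onInputAnd (k : Fin n) (m : Matrix (Bits n) (Bits n) ℂ) :
    m ⊗ₖ (1 : Matrix (Bits n) (Bits n) ℂ)
      = onInputAnd k (m ⊗ₖ (1 : Matrix (Fin 2) (Fin 2) ℂ)) := by
  ext p q
  have : p.2 = q.2 ↔ (∀ i, i ≠ k → p.2 i = q.2 i) ∧ p.2 k = q.2 k := by
    constructor
    · intro h; simp [h]
    · rintro ⟨h1, h2⟩
      funext i
      by_cases hi : i = k
      · rw [hi, h2]
      · exact h1 i hi
  simp only [kroneckerMap_apply, onInputAnd, of_apply, one_apply, this, ite_and, mul_ite, mul_zero]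

/-- Conjugation with the perceptron `V`, and expectation value in the initial state `|0⟩` of its
output qubit. -/
def compress (V W : Matrix (PBits n) (PBits n) ℂ) : Matrix (Bits n) (Bits n) ℂ :=
  (Vᴴ * W * V).submatrix (fun a => (a, 0)) fun a => (a, 0)

theorem pull_onInputAnd (k : Fin n) (V W : Matrix (PBits n) (PBits n) ℂ) :
    pull k V (onInputAnd k W) = compress V W ⊗ₖ (1 : Matrix (Bits n) (Bits n) ℂ) := by
  ext p q
  rw [kronecker_one_eq_onInputAnd k]
  rw [pull, of_apply, block_onInputAnd]
  simp only [onInputAnd, of_apply, kroneckerMap_apply, one_apply, compress, submatrix_apply]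
  by_cases h : ∀ i, i ≠ k → p.2 i = q.2 i
  · simp only [if_pos h, mul_ite, mul_one, mul_zero]
  · simp only [if_neg h, Matrix.mul_zero, Matrix.zero_mul, Matrix.zero_apply, ite_self]

theorem block_one_kronecker_onOutput {j k : Fin n} (hjk : j ≠ k) (Q : Matrix (Fin 2) (Fin 2) ℂ)
    (p q : NBits n) :
    ∃ c : ℂ, block k ((1 : Matrix (Bits n) (Bits n) ℂ) ⊗ₖ onOutput j Q) p q = c • 1 := by
  refine ⟨if ∀ i, i ≠ j → i ≠ k → p.2 i = q.2 i then Q (p.2 j) (q.2 j) else 0, ?_⟩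
  ext x y
  have h : (∀ i, i ≠ j → Function.update p.2 k x.2 i = Function.update q.2 k y.2 i) ↔
      (∀ i, i ≠ j → i ≠ k → p.2 i = q.2 i) ∧ x.2 = y.2 := by
    constructor
    · intro h
      refine ⟨fun i hi hk => ?_, ?_⟩
      · simpa [hk] using h i hi
      · simpa using h k hjk.symm
    · rintro ⟨h1, h2⟩ i hi
      by_cases hk : i = k
      · subst hk; simp [h2]
      · simpa [hk] using h1 i hi hk
  have h2 : x = y ↔ x.1 = y.1 ∧ x.2 = y.2 := Prod.ext_iff
  simp only [block, put, of_apply, kroneckerMap_apply, onOutput, h, one_apply, Matrix.smul_apply,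
    smul_eq_mul, h2, Function.update_of_ne hjk]
  by_cases h3 : ∀ i, i ≠ j → i ≠ k → p.2 i = q.2 i
  · by_cases h4 : x.2 = y.2
    · simp only [h4, and_true, if_pos h3]
      ring
    · simp only [h4, and_false, if_false, mul_zero]
  · simp only [if_neg h3, if_neg fun h => h3 (And.left h), mul_zero, zero_mul]

theorem pull_one_kronecker_onOutput {j k : Fin n} (hjk : j ≠ k)
    {V : Matrix (PBits n) (PBits n) ℂ} (hV : V ∈ unitaryGroup (PBits n) ℂ)
    (Q : Matrix (Fin 2) (Fin 2) ℂ) :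
    pull k V ((1 : Matrix (Bits n) (Bits n) ℂ) ⊗ₖ onOutput j Q)
      = (1 : Matrix (Bits n) (Bits n) ℂ) ⊗ₖ onOutput j Q := by
  have hu : Vᴴ * V = 1 := mem_unitaryGroup_iff'.mp hV
  ext p q
  obtain ⟨c, hc⟩ := block_one_kronecker_onOutput hjk Q p q
  have h1 : ((1 : Matrix (Bits n) (Bits n) ℂ) ⊗ₖ onOutput j Q) p q
      = block k ((1 : Matrix (Bits n) (Bits n) ℂ) ⊗ₖ onOutput j Q) p q (site k p) (site k q) := by
    rw [block, of_apply, put_site, put_site]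
  rw [h1, pull, of_apply, hc, Matrix.mul_smul, Matrix.smul_mul, Matrix.mul_one, hu]
  simp only [Matrix.smul_apply, one_apply, site, Prod.mk.injEq, and_true, smul_eq_mul, ite_and]
  by_cases h : p.2 k = q.2 k <;> simp [h]

/-- A perceptron exerts no force on an observable of an output qubit other than its own, unless the
observable has been pulled back through further perceptrons. -/
theorem force_one_kronecker_onOutput {j k : Fin n} (hjk : j ≠ k)
    {H : Matrix (PBits n) (PBits n) ℂ} (hH : H.IsHermitian) {Q : Matrix (Fin 2) (Fin 2) ℂ}
    (hQ : ((1 : Matrix (Bits n) (Bits n) ℂ) ⊗ₖ onOutput j Q).IsHermitian) (ψ : NBits n → ℂ) :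
    force k H ((1 : Matrix (Bits n) (Bits n) ℂ) ⊗ₖ onOutput j Q) ψ = 0 := by
  set M := (1 : Matrix (Bits n) (Bits n) ℂ) ⊗ₖ onOutput j Q with hM
  have hcomm : M * onInputAnd k H = onInputAnd k H * M := by
    ext p q
    obtain ⟨c, hc⟩ := block_one_kronecker_onOutput hjk Q p q
    have h1 : (M * onInputAnd k H) p q = (block k M p q * H) (site k p) (site k q) := by
      rw [mul_onInputAnd_apply, mul_apply]
      simp [block]
    have h2 : (onInputAnd k H * M) p q = (H * block k M p q) (site k p) (site k q) := by
      rw [onInputAnd_mul_apply, mul_apply]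
      simp [block]
    rw [h1, h2, hc]
    simp
  have hZ : (M * onInputAnd k H)ᴴ = M * onInputAnd k H := by
    rw [conjTranspose_mul, onInputAnd_conjTranspose, hH, hQ, hcomm]
  have h1 : star (star ψ ⬝ᵥ ((M * onInputAnd k H) *ᵥ ψ))
      = star ψ ⬝ᵥ ((M * onInputAnd k H) *ᵥ ψ) := by
    rw [← star_dotProduct, star_mulVec, hZ, ← dotProduct_mulVec]
  have h2 := Complex.conj_eq_iff_im.mp h1
  rw [force, onInputAnd_smul, smul_mulVec, mulVec_smul, mulVec_mulVec, dotProduct_smul]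
  simp [h2]

theorem heis_onOutput_of_lt {V : Fin n → Matrix (PBits n) (PBits n) ℂ}
    (hV : ∀ k, V k ∈ unitaryGroup (PBits n) ℂ) (j : Fin n) (Q : Matrix (Fin 2) (Fin 2) ℂ)
    (i : Fin (n + 1)) : j.castSucc < i →
    heis V ((1 : Matrix (Bits n) (Bits n) ℂ) ⊗ₖ onOutput j Q) i = 1 ⊗ₖ onOutput j Q := by
  induction i using Fin.reverseInduction with
  | last => intro _; rw [heis_last]
  | cast k ih =>
    intro h
    have hjk : j < k := Fin.castSucc_lt_castSucc_iff.mp h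
    rw [heis_castSucc, ih (h.trans Fin.castSucc_lt_succ),
      pull_one_kronecker_onOutput hjk.ne (hV k)]

/-- Before the perceptron of the output qubit `j` acts, an observable of that qubit is an observable
of the input layer alone. -/
theorem exists_heis_onOutput_eq_kronecker_one {V : Fin n → Matrix (PBits n) (PBits n) ℂ}
    (hV : ∀ k, V k ∈ unitaryGroup (PBits n) ℂ) (j : Fin n) (Q : Matrix (Fin 2) (Fin 2) ℂ)
    (i : Fin (n + 1)) : i ≤ j.castSucc →
    ∃ m : Matrix (Bits n) (Bits n) ℂ,
      heis V ((1 : Matrix (Bits n) (Bits n) ℂ) ⊗ₖ onOutput j Q) i = m ⊗ₖ 1 := by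
  induction i using Fin.reverseInduction with
  | last => intro h; exact absurd h (not_le.mpr (Fin.castSucc_lt_last j))
  | cast k ih =>
    intro h
    rw [heis_castSucc]
    rcases (Fin.castSucc_le_castSucc_iff.mp h).eq_or_lt with rfl | hlt
    · rw [heis_onOutput_of_lt hV _ _ _ Fin.castSucc_lt_succ, one_kronecker_onOutput,
        pull_onInputAnd]
      exact ⟨_, rfl⟩
    · obtain ⟨m, hm⟩ := ih (Fin.succ_le_castSucc_iff.mpr hlt)
      rw [hm, kronecker_one_eq_onInputAnd k, pull_onInputAnd]
      exact ⟨_, rfl⟩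

theorem heis_onOutput_eq_onInputAnd {V : Fin n → Matrix (PBits n) (PBits n) ℂ}
    (hV : ∀ k, V k ∈ unitaryGroup (PBits n) ℂ) {j k : Fin n} (hkj : k ≤ j)
    (Q : Matrix (Fin 2) (Fin 2) ℂ) :
    heis V ((1 : Matrix (Bits n) (Bits n) ℂ) ⊗ₖ onOutput j Q) k.succ
      = onInputAnd k (block k (heis V (1 ⊗ₖ onOutput j Q) k.succ) 0 0) := by
  obtain ⟨W, hW⟩ : ∃ W, heis V ((1 : Matrix (Bits n) (Bits n) ℂ) ⊗ₖ onOutput j Q) k.succ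
      = onInputAnd k W := by
    rcases hkj.eq_or_lt with rfl | hlt
    · rw [heis_onOutput_of_lt hV _ _ _ Fin.castSucc_lt_succ, one_kronecker_onOutput]
      exact ⟨_, rfl⟩
    · obtain ⟨m, hm⟩ := exists_heis_onOutput_eq_kronecker_one hV j Q k.succ
        (Fin.succ_le_castSucc_iff.mpr hlt)
      rw [hm, kronecker_one_eq_onInputAnd k]
      exact ⟨_, rfl⟩
  rw [hW, block_onInputAnd, if_pos fun _ _ => rfl]

/-- The normalized trace. -/
noncomputable def ntrace {m : Type*} [Fintype m] (W : Matrix m m ℂ) : ℝ :=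
  W.trace.re / Fintype.card m

/-- The squared Frobenius distance of `W` from the scalars. -/
noncomputable def spread {m : Type*} [Fintype m] [DecidableEq m] (W : Matrix m m ℂ) : ℝ :=
  fsq (W - (ntrace W : ℂ) • 1)

theorem fsq_sub_smul_one {m : Type*} [Fintype m] [DecidableEq m] (W : Matrix m m ℂ) (c : ℝ) :
    fsq (W - (c : ℂ) • 1) = fsq W - 2 * c * W.trace.re + c ^ 2 * Fintype.card m := by
  have h : (fsq (W - (c : ℂ) • 1) : ℂ)
      = fsq W - c * (W.trace + star W.trace) + c ^ 2 * Fintype.card m := by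
    rw [fsq_eq_trace, fsq_eq_trace, conjTranspose_sub, conjTranspose_smul, conjTranspose_one,
      ← trace_conjTranspose]
    simp only [Matrix.sub_mul, Matrix.mul_sub, trace_sub, Matrix.smul_mul, Matrix.mul_smul,
      Matrix.one_mul, Matrix.mul_one, trace_smul, trace_one, smul_eq_mul, RCLike.star_def,
      Complex.conj_ofReal]
    ring
  have h2 := congrArg Complex.re h
  rw [RCLike.star_def, Complex.add_conj] at h2
  have h3 : (fsq W : ℂ) - c * ((2 * W.trace.re : ℝ) : ℂ) + c ^ 2 * Fintype.card m
      = ((fsq W - c * (2 * W.trace.re) + c ^ 2 * Fintype.card m : ℝ) : ℂ) := by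
    push_cast; ring
  rw [h3, Complex.ofReal_re, Complex.ofReal_re] at h2
  rw [h2]
  ring

theorem spread_le_fsq_sub {m : Type*} [Fintype m] [DecidableEq m] [Nonempty m] (W : Matrix m m ℂ)
    (c : ℝ) : spread W ≤ fsq (W - (c : ℂ) • 1) := by
  have hd : (0 : ℝ) < Fintype.card m := by exact_mod_cast Fintype.card_pos
  rw [spread, fsq_sub_smul_one, fsq_sub_smul_one, ntrace]
  have : fsq W - 2 * c * W.trace.re + c ^ 2 * Fintype.card m
      - (fsq W - 2 * (W.trace.re / Fintype.card m) * W.trace.re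
        + (W.trace.re / Fintype.card m) ^ 2 * Fintype.card m)
      = Fintype.card m * (c - W.trace.re / Fintype.card m) ^ 2 := by
    field_simp
    ring
  nlinarith [sq_nonneg (c - W.trace.re / Fintype.card m)]

theorem compress_isHermitian (V : Matrix (PBits n) (PBits n) ℂ) {W : Matrix (PBits n) (PBits n) ℂ}
    (hW : W.IsHermitian) : (compress V W).IsHermitian :=
  (isHermitian_conjTranspose_mul_mul V hW).submatrix _

theorem compress_sub_smul_one {V : Matrix (PBits n) (PBits n) ℂ} (hV : V ∈ unitaryGroup (PBits n) ℂ)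
    (W : Matrix (PBits n) (PBits n) ℂ) (c : ℂ) :
    compress V (W - c • 1) = compress V W - c • 1 := by
  have hu : Vᴴ * V = 1 := mem_unitaryGroup_iff'.mp hV
  ext a b
  simp only [compress, submatrix_apply, Matrix.mul_sub, Matrix.sub_mul, Matrix.mul_smul,
    Matrix.smul_mul, Matrix.mul_one, hu, Matrix.sub_apply, Matrix.smul_apply, one_apply,
    Prod.mk.injEq, and_true]

/-- The second moment of a compressed traceless observable is a multiple of the identity. -/
theorem IsUnitaryDesign.expect_compress_mul_compress {Y : Type} [Fintype Y]
    {V : Y → unitaryGroup (PBits n) ℂ} (hV : IsUnitaryDesign 2 V)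
    {W : Matrix (PBits n) (PBits n) ℂ} (hW : W.IsHermitian) (htr : W.trace = 0) (a c : Bits n) :
    𝔼 z, (compress (V z : Matrix (PBits n) (PBits n) ℂ) W * compress (V z) W) a c
      = ((fsq W * ((2 ^ n - 1 / 2 ^ (n + 1)) / ((2 ^ (n + 1)) ^ 2 - 1)) : ℝ) : ℂ)
        * (1 : Matrix (Bits n) (Bits n) ℂ) a c := by
  have hf : (W * W).trace = (fsq W : ℂ) := by rw [fsq_eq_trace, hW]
  have hcard : (Fintype.card (PBits n) : ℂ) = 2 ^ (n + 1) := by rw [card_pBits, pow_succ]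
  have h1 : ∀ z, (compress (V z : Matrix (PBits n) (PBits n) ℂ) W * compress (V z) W) a c
      = ∑ s, ((V z : Matrix (PBits n) (PBits n) ℂ)ᴴ * W * V z) (a, 0) (s, 0)
        * ((V z : Matrix (PBits n) (PBits n) ℂ)ᴴ * W * V z) (s, 0) (c, 0) := fun z => rfl
  simp only [h1, Finset.expect_sum_comm, hV.expect_conj_mul_conj, htr, hf, hcard, Prod.mk.injEq,
    and_true, one_apply, ← Finset.sum_div, Finset.sum_add_distrib, ← Finset.mul_sum]
  by_cases h : a = c
  · subst h
    simp [Bits]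
    ring
  · simp [h]

end Local

/-! ### The forces for the local cost -/

section LocalForce

open scoped BigOperators ComplexOrder

variable {n : ℕ}

/-- For random Hermitian matrices whose squares average to `b • 1`. -/
theorem expect_fsq_mul_kronecker_one {Ω l m ι : Type*} [Fintype Ω] [Fintype l] [Fintype m]
    [DecidableEq m] [Fintype ι] [DecidableEq ι] (X : Matrix l (ι × m) ℂ) {t : Ω → Matrix ι ι ℂ}
    (ht : ∀ z, (t z).IsHermitian) {b : ℝ}
    (hb : ∀ i j, 𝔼 z, (t z * t z) i j = (b : ℂ) * (1 : Matrix ι ι ℂ) i j) :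
    𝔼 z, fsq (X * (t z ⊗ₖ (1 : Matrix m m ℂ))) = b * fsq X := by
  have h1 : ∀ z, (fsq (X * (t z ⊗ₖ (1 : Matrix m m ℂ))) : ℂ)
      = ∑ x, ∑ p, ∑ q, (X x q * star (X x p))
        * ((t z * t z) q.1 p.1 * (1 : Matrix m m ℂ) q.2 p.2) := by
    intro z
    have h2 : X * (t z ⊗ₖ (1 : Matrix m m ℂ)) * (X * (t z ⊗ₖ (1 : Matrix m m ℂ)))ᴴ
        = X * ((t z * t z) ⊗ₖ (1 : Matrix m m ℂ)) * Xᴴ := by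
      rw [conjTranspose_mul, conjTranspose_kronecker, ht, conjTranspose_one, ← Matrix.mul_assoc,
        Matrix.mul_assoc X, ← mul_kronecker_mul, Matrix.one_mul]
    rw [fsq_eq_trace, h2]
    generalize t z * t z = T
    simp only [trace, diag, Matrix.mul_apply, conjTranspose_apply, Finset.sum_mul,
      kroneckerMap_apply]
    refine Finset.sum_congr rfl fun x _ => Finset.sum_congr rfl fun p _ =>
      Finset.sum_congr rfl fun q _ => ?_
    ring
  have h3 : ((𝔼 z, fsq (X * (t z ⊗ₖ (1 : Matrix m m ℂ))) : ℝ) : ℂ) = b * (X * Xᴴ).trace := by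
    rw [Fintype.expect_eq_sum_div_card]
    push_cast
    rw [← Fintype.expect_eq_sum_div_card]
    simp only [h1, Finset.expect_sum_comm, ← Finset.mul_expect, ← Finset.expect_mul, hb]
    simp only [trace, diag, Matrix.mul_apply, conjTranspose_apply, Finset.mul_sum]
    refine Finset.sum_congr rfl fun x _ => Finset.sum_congr rfl fun p _ => ?_
    rw [Finset.sum_eq_single p]
    · simp only [one_apply_eq]
      ring
    · intro q _ hq
      have : ¬ (q.1 = p.1 ∧ q.2 = p.2) := fun h => hq (Prod.ext h.1 h.2)
      simp only [one_apply]
      by_cases h4 : q.1 = p.1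
      · have h5 : q.2 ≠ p.2 := fun h5 => this ⟨h4, h5⟩
        simp [h5]
      · simp [h4]
    · simp
  rw [← fsq_eq_trace] at h3
  exact_mod_cast h3

theorem spread_nonneg {m : Type*} [Fintype m] [DecidableEq m] (W : Matrix m m ℂ) : 0 ≤ spread W :=
  fsq_nonneg _

theorem trace_sub_ntrace_smul_one {m : Type*} [Fintype m] [DecidableEq m] [Nonempty m]
    {W : Matrix m m ℂ} (hW : W.IsHermitian) : (W - (ntrace W : ℂ) • 1).trace = 0 := by
  have hd : (Fintype.card m : ℂ) ≠ 0 := by exact_mod_cast Fintype.card_ne_zero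
  have h : ((W.trace.re : ℝ) : ℂ) = W.trace := by
    have := trace_conjTranspose W
    rw [hW] at this
    exact Complex.conj_eq_iff_re.mp this.symm
  rw [trace_sub, trace_smul, trace_one, ntrace, smul_eq_mul]
  push_cast
  rw [h]
  field_simp
  simp

theorem compress_kronecker_one_sub {m : Type*} [DecidableEq m] {V : Matrix (PBits n) (PBits n) ℂ}
    (hV : V ∈ unitaryGroup (PBits n) ℂ) (W : Matrix (PBits n) (PBits n) ℂ) (c : ℂ) :
    compress V W ⊗ₖ (1 : Matrix m m ℂ) - c • 1 = compress V (W - c • 1) ⊗ₖ 1 := by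
  rw [compress_sub_smul_one hV, ← one_kronecker_one]
  ext p q
  simp only [Matrix.sub_apply, Matrix.smul_apply, kroneckerMap_apply, smul_eq_mul]
  ring

/-- The right-hand side is `1 / (2 d)` for `d = 2 ^ (n + 1)`. -/
theorem compress_constant_le (n : ℕ) :
    ((2 : ℝ) ^ n - 1 / 2 ^ (n + 1)) / ((2 ^ (n + 1)) ^ 2 - 1) ≤ 1 / 2 ^ (n + 2) := by
  have hD : (1 : ℝ) ≤ 2 ^ n := one_le_pow₀ (by norm_num)
  rw [pow_succ, pow_add]
  generalize (2 : ℝ) ^ n = D at hD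
  have h1 : 0 < (D * 2) ^ 2 - 1 := by nlinarith
  rw [div_le_div_iff₀ h1 (by positivity)]
  have h2 : (D - 1 / (D * 2)) * (D * 2 ^ 2) = 4 * D ^ 2 - 2 := by field_simp; ring
  rw [h2]
  nlinarith

/-- A compressed observable is close to a scalar: this is where the average over a perceptron
suppresses the forces of the earlier perceptrons. -/
theorem IsUnitaryDesign.expect_fsq_mul_compress_le {Y : Type} [Fintype Y]
    {V : Y → unitaryGroup (PBits n) ℂ} (hV : IsUnitaryDesign 2 V)
    {W : Matrix (PBits n) (PBits n) ℂ} (hW : W.IsHermitian) {l m : Type*} [Fintype l] [Fintype m]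
    [DecidableEq m] (X : Matrix l (Bits n × m) ℂ) :
    𝔼 z, fsq (X * (compress (V z : Matrix (PBits n) (PBits n) ℂ) W ⊗ₖ (1 : Matrix m m ℂ)
        - (ntrace W : ℂ) • 1))
      ≤ spread W / 2 ^ (n + 2) * fsq X := by
  have hW0 : (W - (ntrace W : ℂ) • 1).IsHermitian := by
    rw [IsHermitian, conjTranspose_sub, hW, conjTranspose_smul]
    simp
  have h1 := fun z => compress_isHermitian (V z : Matrix (PBits n) (PBits n) ℂ) hW0
  have h2 := hV.expect_compress_mul_compress hW0 (trace_sub_ntrace_smul_one hW)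
  have h3 := fun z => compress_kronecker_one_sub (m := m) (V z).2 W (ntrace W : ℂ)
  simp only [h3]
  rw [expect_fsq_mul_kronecker_one (m := m) X h1 h2]
  refine mul_le_mul_of_nonneg_right ?_ (fsq_nonneg _)
  rw [spread, div_eq_mul_one_div (fsq _)]
  refine mul_le_mul_of_nonneg_left ?_ (fsq_nonneg _)
  exact compress_constant_le n

theorem IsUnitaryDesign.expect_spread_compress_le {Y : Type} [Fintype Y]
    {V : Y → unitaryGroup (PBits n) ℂ} (hV : IsUnitaryDesign 2 V)
    {W : Matrix (PBits n) (PBits n) ℂ} (hW : W.IsHermitian) :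
    𝔼 z, spread (compress (V z : Matrix (PBits n) (PBits n) ℂ) W ⊗ₖ (1 : Matrix (Fin 2) (Fin 2) ℂ))
      ≤ 1 / 2 * spread W := by
  have h := hV.expect_fsq_mul_compress_le hW (m := Fin 2) (1 : Matrix (PBits n) (PBits n) ℂ)
  have h1 : fsq (1 : Matrix (PBits n) (PBits n) ℂ) = 2 ^ (n + 1) := by
    rw [fsq_of_isHermitian isHermitian_one, Matrix.one_mul, trace_one, card_pBits, pow_succ]
    norm_cast
  rw [h1] at h
  simp only [Matrix.one_mul] at h
  refine (Finset.expect_le_expect fun z _ => spread_le_fsq_sub _ _).trans (h.trans_eq ?_)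
  rw [pow_succ 2 (n + 1)]
  field_simp

/-- The observable `Q` of the output qubit `j`, pulled back to the time just after the perceptron
`k`, as an operator on the space of that perceptron. For `k ≤ j` this loses no information. -/
def localBlock (V : Fin n → Matrix (PBits n) (PBits n) ℂ) (j : Fin n) (Q : Matrix (Fin 2) (Fin 2) ℂ)
    (k : Fin n) : Matrix (PBits n) (PBits n) ℂ :=
  block k (heis V ((1 : Matrix (Bits n) (Bits n) ℂ) ⊗ₖ onOutput j Q) k.succ) 0 0

/-- The hypothesis `hkl` says that the perceptron `l` comes directly after `k`. -/
theorem heis_succ_eq_compress {V : Fin n → Matrix (PBits n) (PBits n) ℂ}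
    (hV : ∀ k, V k ∈ unitaryGroup (PBits n) ℂ) {j k l : Fin n} (hkl : k.succ = l.castSucc)
    (hlj : l ≤ j) (Q : Matrix (Fin 2) (Fin 2) ℂ) :
    heis V ((1 : Matrix (Bits n) (Bits n) ℂ) ⊗ₖ onOutput j Q) k.succ
      = compress (V l) (localBlock V j Q l) ⊗ₖ (1 : Matrix (Bits n) (Bits n) ℂ) := by
  rw [hkl, heis_castSucc, heis_onOutput_eq_onInputAnd hV hlj, pull_onInputAnd]
  rfl

theorem localBlock_eq_compress {V : Fin n → Matrix (PBits n) (PBits n) ℂ}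
    (hV : ∀ k, V k ∈ unitaryGroup (PBits n) ℂ) {j k l : Fin n} (hkl : k.succ = l.castSucc)
    (hlj : l ≤ j) (Q : Matrix (Fin 2) (Fin 2) ℂ) :
    localBlock V j Q k
      = compress (V l) (localBlock V j Q l) ⊗ₖ (1 : Matrix (Fin 2) (Fin 2) ℂ) := by
  rw [localBlock, heis_succ_eq_compress hV hkl hlj, kronecker_one_eq_onInputAnd k, block_onInputAnd,
    if_pos fun _ _ => rfl]

theorem localBlock_self {V : Fin n → Matrix (PBits n) (PBits n) ℂ}
    (hV : ∀ k, V k ∈ unitaryGroup (PBits n) ℂ) (j : Fin n) (Q : Matrix (Fin 2) (Fin 2) ℂ) :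
    localBlock V j Q j = (1 : Matrix (Bits n) (Bits n) ℂ) ⊗ₖ Q := by
  rw [localBlock, heis_onOutput_of_lt hV _ _ _ Fin.castSucc_lt_succ, one_kronecker_onOutput,
    block_onInputAnd, if_pos fun _ _ => rfl]

theorem localBlock_isHermitian (V : Fin n → Matrix (PBits n) (PBits n) ℂ) (j k : Fin n)
    {Q : Matrix (Fin 2) (Fin 2) ℂ}
    (hQ : ((1 : Matrix (Bits n) (Bits n) ℂ) ⊗ₖ onOutput j Q).PosSemidef) :
    (localBlock V j Q k).IsHermitian :=
  (heis_posSemidef V hQ k.succ).1.submatrix _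

section Averages

variable {Y : Fin n → Type} {V : ∀ j, Y j → unitaryGroup (PBits n) ℂ}

theorem localBlock_drawn_update (y : ∀ j, Y j) (j : Fin n) (Q : Matrix (Fin 2) (Fin 2) ℂ)
    (k : Fin n) (z : Y k) :
    localBlock (drawn V (Function.update y k z)) j Q k = localBlock (drawn V y) j Q k := by
  rw [localBlock, localBlock, heis_drawn_update _ y z Fin.castSucc_lt_succ]

variable [∀ j, Fintype (Y j)]

/-- Each perceptron between `k` and `j` halves the mean spread of the pulled back observable. -/
theorem expect_spread_localBlock_le (hV : ∀ j, IsUnitaryDesign 2 (V j)) (j : Fin n)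
    {Q : Matrix (Fin 2) (Fin 2) ℂ}
    (hQ : ((1 : Matrix (Bits n) (Bits n) ℂ) ⊗ₖ onOutput j Q).PosSemidef) (m : ℕ) :
    ∀ k : Fin n, (k : ℕ) + m = j → 𝔼 y, spread (localBlock (drawn V y) j Q k)
      ≤ spread ((1 : Matrix (Bits n) (Bits n) ℂ) ⊗ₖ Q) * (1 / 2) ^ m := by
  have hne : ∀ j, Nonempty (Y j) := fun j => (hV j).nonempty
  induction m with
  | zero =>
    intro k hk
    obtain rfl : k = j := Fin.ext hk
    simp only [fun y => localBlock_self (drawn_mem (V := V) y) k Q, Fintype.expect_const, pow_zero,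
      mul_one, le_refl]
  | succ m ih =>
    intro k hk
    let l : Fin n := ⟨k + 1, by omega⟩
    have hkl : k.succ = l.castSucc := rfl
    have hlj : l ≤ j := Fin.le_def.mpr (by simp only [l]; omega)
    have h1 := ih l (by simp only [l]; omega)
    rw [expect_resample l]
    calc _ ≤ 𝔼 y, 1 / 2 * spread (localBlock (drawn V y) j Q l) := by
          refine Finset.expect_le_expect fun y _ => ?_
          have h2 := (hV l).expect_spread_compress_le (localBlock_isHermitian (drawn V y) j l hQ)
          simp only [fun z => localBlock_eq_compress (drawn_mem (V := V) (Function.update y l z))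
            hkl hlj Q, localBlock_drawn_update]
          simpa only [drawn, Function.update_self] using h2
      _ ≤ _ := by
          rw [← Finset.mul_expect, pow_succ]
          linarith

theorem spread_one_kronecker_proj_le {ψ : Fin 2 → ℂ} (hψ : IsState ψ) :
    spread ((1 : Matrix (Bits n) (Bits n) ℂ) ⊗ₖ proj ψ) ≤ 2 ^ (n + 1) := by
  refine (spread_le_fsq_sub _ 0).trans ?_
  have h : ((1 : Matrix (Bits n) (Bits n) ℂ) ⊗ₖ proj ψ).IsHermitian := by
    rw [IsHermitian, conjTranspose_kronecker, conjTranspose_one, proj_isHermitian]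
  rw [Complex.ofReal_zero, zero_smul, sub_zero, fsq_of_isHermitian h, ← mul_kronecker_mul,
    Matrix.one_mul, proj_mul_proj hψ, trace_kronecker, trace_proj hψ, trace_one, mul_one, pow_succ]
  have : ((Fintype.card (Bits n) : ℂ)).re = 2 ^ n := by
    rw [Complex.natCast_re]; simp [Bits]
  rw [this]
  have : (0 : ℝ) < 2 ^ n := by positivity
  linarith

theorem onOutput_projection (j : Fin n) {ψ : Fin 2 → ℂ} (hψ : IsState ψ) :
    ((1 : Matrix (Bits n) (Bits n) ℂ) ⊗ₖ onOutput j (proj ψ)).IsHermitian ∧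
      ((1 : Matrix (Bits n) (Bits n) ℂ) ⊗ₖ onOutput j (proj ψ)) * (1 ⊗ₖ onOutput j (proj ψ))
        = 1 ⊗ₖ onOutput j (proj ψ) := by
  rw [one_kronecker_onOutput]
  constructor
  · rw [IsHermitian, onInputAnd_conjTranspose, conjTranspose_kronecker, conjTranspose_one,
      proj_isHermitian]
  · rw [onInputAnd_mul_onInputAnd, ← mul_kronecker_mul, Matrix.one_mul, proj_mul_proj hψ]

/-- The mean square force for a projector of the output qubit `j`. For `k < j`, the observable is
shifted by the normalized trace of its pullback to the time just after the next perceptron. -/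
theorem expect_force_local_sq_le (hV : ∀ j, IsUnitaryDesign 2 (V j)) {j k : Fin n} (hkj : k ≤ j)
    {H : Matrix (PBits n) (PBits n) ℂ} (hH : H.IsHermitian) (hH2 : fsq H ≤ 2 ^ (n + 1))
    {φ : Bits n → ℂ} (hφ : IsState φ) {ψ : Fin 2 → ℂ} (hψ : IsState ψ) :
    𝔼 y, force k H
        (heis (drawn V y) ((1 : Matrix (Bits n) (Bits n) ℂ) ⊗ₖ onOutput j (proj ψ)) k.succ)
        (stateAfter (drawn V y) (inputState φ) (k + 1)) ^ 2
      ≤ 4 / ((2 ^ (n + 1) : ℝ) ^ 2 - 1) * 2 ^ (n + 1) * (1 / 2) ^ ((j : ℕ) - k) := by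
  have hne : ∀ j, Nonempty (Y j) := fun j => (hV j).nonempty
  obtain ⟨hMh, hMM⟩ := onOutput_projection j hψ
  have hM1 := posSemidef_of_projection hMh hMM
  have hM2 := one_sub_posSemidef_of_projection hMh hMM
  have h0 : (1 : ℝ) < 2 ^ (n + 1) := one_lt_pow₀ (by norm_num) (by omega)
  have hC : 0 ≤ 4 / ((2 ^ (n + 1) : ℝ) ^ 2 - 1) := by
    apply div_nonneg <;> nlinarith
  have hX : ∀ y, fsq (leverage k H (stateAfter (drawn V y) (inputState φ) k)) ≤ 2 ^ (n + 1) :=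
    fun y => (fsq_leverage_stateAfter k H hφ y).trans_le hH2
  rw [mul_assoc]
  rcases hkj.eq_or_lt with rfl | hlt
  · refine (expect_force_sq_le hV k hH hM1 (fun _ => 0) hφ).trans (mul_le_mul_of_nonneg_left ?_ hC)
    rw [Nat.sub_self, pow_zero, mul_one]
    refine Finset.expect_le Finset.univ_nonempty fun y _ => ?_
    rw [Complex.ofReal_zero, zero_smul, sub_zero, heis_onOutput_of_lt (drawn_mem y) _ _ _
      Fin.castSucc_lt_succ]
    exact (fsq_mul_le _ hM1 hM2).trans (hX y)
  · let l : Fin n := ⟨k + 1, by omega⟩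
    have hkl : k.succ = l.castSucc := rfl
    have hlj : l ≤ j := hlt
    have hk : (k : ℕ) ≤ l := Nat.le_succ _
    refine (expect_force_sq_le hV k hH hM1
      (fun y => ntrace (localBlock (drawn V y) j (proj ψ) l)) hφ).trans
      (mul_le_mul_of_nonneg_left ?_ hC)
    rw [expect_resample l]
    calc _ ≤ 𝔼 y, spread (localBlock (drawn V y) j (proj ψ) l) * (1 / 2) := by
          refine Finset.expect_le_expect fun y _ => ?_
          have h2 := (hV l).expect_fsq_mul_compress_le (m := Bits n)
            (localBlock_isHermitian (drawn V y) j l hM1)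
            (leverage k H (stateAfter (drawn V y) (inputState φ) k))
          simp only [fun z => heis_succ_eq_compress (drawn_mem (V := V) (Function.update y l z))
            hkl hlj (proj ψ), localBlock_drawn_update, stateAfter_drawn_update _ y _ hk]
          simp only [drawn, Function.update_self] at h2 ⊢
          refine h2.trans ?_
          rw [div_mul_eq_mul_div, mul_div_assoc]
          refine mul_le_mul_of_nonneg_left ?_ (spread_nonneg _)
          rw [div_le_iff₀ (by positivity)]
          refine (hX y).trans_eq ?_
          ring
      _ ≤ _ := by
          have h3 := expect_spread_localBlock_le hV j hM1 ((j : ℕ) - l) l (by omega)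
          have h4 := spread_one_kronecker_proj_le (n := n) hψ
          rw [← Finset.expect_mul, show (j : ℕ) - k = (j : ℕ) - l + 1 by simp only [l]; omega,
            pow_succ _ ((j : ℕ) - l), ← mul_assoc]
          refine mul_le_mul_of_nonneg_right (h3.trans ?_) (by norm_num)
          gcongr

end Averages

end LocalForce

/-! ### The variance of the derivative -/

section Variance

open scoped BigOperators ComplexOrder

variable {n : ℕ}

theorem force_one_sub (k : Fin n) {H : Matrix (PBits n) (PBits n) ℂ} (hH : H.IsHermitian)
    (M : Matrix (NBits n) (NBits n) ℂ) (ψ : NBits n → ℂ) :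
    force k H (1 - M) ψ = -force k H M ψ := by
  rw [← force_sub_smul_one k hH M 1, ← neg_sub, force, force, neg_mulVec, dotProduct_neg]
  simp

theorem drift_one_sub {H V : Fin n → Matrix (PBits n) (PBits n) ℂ} (hH : ∀ k, (H k).IsHermitian)
    (hV : ∀ k, V k ∈ unitaryGroup (PBits n) ℂ) (φ : Bits n → ℂ) (P : Matrix (Bits n) (Bits n) ℂ) :
    drift H V φ (1 - P) = -drift H V φ P := by
  have h : (1 : Matrix (Bits n) (Bits n) ℂ) ⊗ₖ (1 - P) = 1 - 1 ⊗ₖ P := by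
    rw [← one_kronecker_one]
    ext p q
    simp only [Matrix.sub_apply, kroneckerMap_apply, mul_sub]
  rw [drift, drift, h, ← Finset.sum_neg_distrib]
  refine Finset.sum_congr rfl fun k _ => ?_
  rw [heis_one_sub hV, force_one_sub k (hH k)]

theorem onOutput_isHermitian (j : Fin n) {Q : Matrix (Fin 2) (Fin 2) ℂ} (hQ : Q.IsHermitian) :
    (onOutput j Q).IsHermitian := by
  ext b c
  simp only [onOutput, conjTranspose_apply, of_apply, apply_ite star, star_zero, hQ.apply, eq_comm]

theorem one_sub_isHermitian {m : Type*} [DecidableEq m] {P : Matrix m m ℂ}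
    (hP : P.IsHermitian) : (1 - P).IsHermitian := isHermitian_one.sub hP

theorem localOp_eq (hn : 1 ≤ n) (ψ : Fin n → Fin 2 → ℂ) :
    localOp ψ = ((1 / (n : ℝ) : ℝ) : ℂ) • ∑ j, (1 - onOutput j (proj (ψ j))) := by
  have : (n : ℂ) ≠ 0 := by exact_mod_cast (by omega : n ≠ 0)
  rw [localOp, Finset.sum_sub_distrib, smul_sub, Finset.sum_const, Finset.card_univ,
    Fintype.card_fin, ← Nat.cast_smul_eq_nsmul ℂ, smul_smul]
  push_cast
  rw [one_div, inv_mul_cancel₀ this, one_smul]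

theorem localOp_isHermitian (ψ : Fin n → Fin 2 → ℂ) : (localOp ψ).IsHermitian := by
  refine one_sub_isHermitian ?_
  have h : (∑ j, onOutput j (proj (ψ j))).IsHermitian := by
    rw [IsHermitian, conjTranspose_sum]
    exact Finset.sum_congr rfl fun j _ => onOutput_isHermitian j (proj_isHermitian _)
  rw [IsHermitian, conjTranspose_smul, h]
  simp

/-- Linearity in the observable, read off from the uniqueness of the derivative. -/
theorem drift_localOp (hn : 1 ≤ n) (H V : Fin n → Matrix (PBits n) (PBits n) ℂ) (φ : Bits n → ℂ)
    (ψ : Fin n → Fin 2 → ℂ) :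
    drift H V φ (localOp ψ) = 1 / (n : ℝ) * ∑ j, drift H V φ (1 - onOutput j (proj (ψ j))) := by
  have h1 := hasDerivAt_trace_mul_outState H V φ (localOp_isHermitian ψ)
  have h2 := HasDerivAt.const_mul (1 / (n : ℝ)) (HasDerivAt.fun_sum (u := Finset.univ)
    fun j _ => hasDerivAt_trace_mul_outState H V φ
      (one_sub_isHermitian (onOutput_isHermitian j (proj_isHermitian (ψ j)))))
  refine h1.unique (h2.congr_of_eventuallyEq (Filter.Eventually.of_forall fun ε => ?_))
  simp only [localOp_eq hn, Matrix.smul_mul, Matrix.sum_mul, trace_smul, trace_sum, smul_eq_mul,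
    Complex.re_ofReal_mul, Complex.re_sum]

theorem mean_sq_le {N : ℕ} (hN : 1 ≤ N) (a : Fin N → ℝ) :
    (1 / (N : ℝ) * ∑ x, a x) ^ 2 ≤ 1 / (N : ℝ) * ∑ x, a x ^ 2 := by
  have h := sq_sum_le_card_mul_sum_sq (s := Finset.univ) (f := a)
  rw [Finset.card_univ, Fintype.card_fin] at h
  have h0 : (0 : ℝ) < N := by exact_mod_cast hN
  rw [mul_pow]
  calc _ ≤ (1 / (N : ℝ)) ^ 2 * (N * ∑ x, a x ^ 2) := by gcongr
    _ = _ := by field_simp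

variable {Y : Fin n → Type} [∀ j, Fintype (Y j)] {V : ∀ j, Y j → unitaryGroup (PBits n) ℂ}

theorem expect_mean_sq_le {N : ℕ} (hN : 1 ≤ N) {Ω : Type*} [Fintype Ω] (a : Fin N → Ω → ℝ) {C : ℝ}
    (ha : ∀ x, 𝔼 y, a x y ^ 2 ≤ C) : 𝔼 y, (1 / (N : ℝ) * ∑ x, a x y) ^ 2 ≤ C := by
  have h0 : (0 : ℝ) < N := by exact_mod_cast hN
  calc _ ≤ 𝔼 y, 1 / (N : ℝ) * ∑ x, a x y ^ 2 :=
        Finset.expect_le_expect fun y _ => mean_sq_le hN fun x => a x y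
    _ = 1 / (N : ℝ) * ∑ x, 𝔼 y, a x y ^ 2 := by
        rw [← Finset.mul_expect, Finset.expect_sum_comm]
    _ ≤ 1 / (N : ℝ) * ∑ _x : Fin N, C := by
        gcongr with x _
        exact ha x
    _ = C := by
        rw [Finset.sum_const, Finset.card_univ, Fintype.card_fin, nsmul_eq_mul]
        field_simp

theorem variance_dCost_le {N : ℕ} (hN : 1 ≤ N) (φ : Fin N → Bits n → ℂ)
    {O : Fin N → Matrix (Bits n) (Bits n) ℂ} (hO : ∀ x, (O x).IsHermitian)
    (H : Fin n → Matrix (PBits n) (PBits n) ℂ) {C : ℝ}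
    (hC : ∀ x, 𝔼 y, drift H (drawn V y) (φ x) (O x) ^ 2 ≤ C) :
    (∀ y : ∀ j, Y j, DifferentiableAt ℝ (costAlong φ O H fun j => V j (y j)) 0) ∧
      variance (fun y : ∀ j, Y j => dCost φ O H fun j => V j (y j)) ≤ C := by
  refine ⟨fun y => (hasDerivAt_costAlong φ hO H _).differentiableAt, ?_⟩
  have h : ∀ y : ∀ j, Y j, dCost φ O H (fun j => V j (y j))
      = 1 / (N : ℝ) * ∑ x, drift H (drawn V y) (φ x) (O x) :=
    fun y => (hasDerivAt_costAlong φ hO H _).deriv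
  simp only [variance, h]
  rw [average_eq_expect]
  exact (sub_le_self _ (sq_nonneg _)).trans
    (expect_mean_sq_le hN (fun x y => drift H (drawn V y) (φ x) (O x)) hC)

/-- The bound on the mean square of the sum of the forces is of the order `1 / 2 ^ n`. -/
theorem force_constant_le (n : ℕ) :
    12 * (4 / ((2 ^ (n + 1) : ℝ) ^ 2 - 1) * 2 ^ (n + 1)) ≤ 48 * (1 / 2 ^ n) := by
  have hD : (1 : ℝ) ≤ 2 ^ n := one_le_pow₀ (by norm_num)
  rw [pow_succ (2 : ℝ) n]
  generalize (2 : ℝ) ^ n = D at hD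
  have h1 : 0 < (D * 2) ^ 2 - 1 := by nlinarith
  rw [← mul_assoc, mul_div_assoc', div_mul_eq_mul_div, mul_one_div,
    div_le_div_iff₀ h1 (by linarith)]
  nlinarith

theorem expect_drift_globalOp_sq_le (hn : 1 ≤ n) (hV : ∀ j, IsUnitaryDesign 2 (V j))
    {H : Fin n → Matrix (PBits n) (PBits n) ℂ} (hH : ∀ k, (H k).IsHermitian)
    (hH2 : ∀ k, fsq (H k) ≤ 2 ^ (n + 1)) {φ χ : Bits n → ℂ} (hφ : IsState φ) (hχ : IsState χ) :
    𝔼 y, drift H (drawn V y) φ (globalOp χ) ^ 2 ≤ 48 * (1 / 2 ^ n) := by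
  simp only [globalOp, drift_one_sub hH (drawn_mem _), neg_sq]
  refine (expect_sum_sq_le (fun k y => force k (H k) (heis (drawn V y)
    ((1 : Matrix (Bits n) (Bits n) ℂ) ⊗ₖ proj χ) k.succ)
      (stateAfter (drawn V y) (inputState φ) (k + 1)))
    ⟨n - 1, by omega⟩ (fun k hk => ?_) fun k _ => ?_).trans (force_constant_le n)
  · exact absurd (Fin.lt_def.mp hk) (by simp only; omega)
  · exact expect_force_global_sq_le hV k (hH k) (hH2 k) hφ hχ

theorem expect_drift_localOp_sq_le (hn : 1 ≤ n) (hV : ∀ j, IsUnitaryDesign 2 (V j))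
    {H : Fin n → Matrix (PBits n) (PBits n) ℂ} (hH : ∀ k, (H k).IsHermitian)
    (hH2 : ∀ k, fsq (H k) ≤ 2 ^ (n + 1)) {φ : Bits n → ℂ} {ψ : Fin n → Fin 2 → ℂ}
    (hφ : IsState φ) (hψ : ∀ j, IsState (ψ j)) :
    𝔼 y, drift H (drawn V y) φ (localOp ψ) ^ 2 ≤ 48 * (1 / 2 ^ n) := by
  simp only [drift_localOp hn]
  refine expect_mean_sq_le hn
    (fun j y => drift H (drawn V y) φ (1 - onOutput j (proj (ψ j)))) fun j => ?_
  simp only [drift_one_sub hH (drawn_mem _), neg_sq]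
  refine (expect_sum_sq_le (fun k y => force k (H k) (heis (drawn V y)
    ((1 : Matrix (Bits n) (Bits n) ℂ) ⊗ₖ onOutput j (proj (ψ j))) k.succ)
      (stateAfter (drawn V y) (inputState φ) (k + 1)))
    j (fun k hk y => ?_) fun k hk => ?_).trans (force_constant_le n)
  · have hjk : j.castSucc < k.succ :=
      (Fin.castSucc_lt_castSucc_iff.mpr hk).trans Fin.castSucc_lt_succ
    rw [heis_onOutput_of_lt (drawn_mem y) _ _ _ hjk]
    exact force_one_kronecker_onOutput hk.ne (hH k) (onOutput_projection j (hψ j)).1 _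
  · exact expect_force_local_sq_le hV hk (hH k) (hH2 k) hφ (hψ j)

end Variance

end DQNN

theorem theorem2 :
    ∃ f : ℕ → ℝ, f =O[Filter.atTop] (fun n : ℕ => 1 / (2 : ℝ) ^ n) ∧
      ∀ n : ℕ, 1 ≤ n →
      -- independent 2-designs on `n + 1` qubits, one for each perceptron
      ∀ (Y : Fin n → Type) [∀ j, Fintype (Y j)]
        (V : ∀ j, Y j → Matrix.unitaryGroup (DQNN.PBits n) ℂ),
        (∀ j, DQNN.IsUnitaryDesign 2 (V j)) →
      -- the generators of the update
      ∀ H : Fin n → Matrix (DQNN.PBits n) (DQNN.PBits n) ℂ,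
        (∀ j, (H j).IsHermitian) →
        (∀ j, (H j * H j).trace.re ≤ 2 ^ (n + 1)) →
      -- the input states of the training data
      ∀ (N : ℕ), 1 ≤ N →
      ∀ φin : Fin N → DQNN.Bits n → ℂ, (∀ x, DQNN.IsState (φin x)) →
        -- the global cost
        (∀ φout : Fin N → DQNN.Bits n → ℂ, (∀ x, DQNN.IsState (φout x)) →
          (∀ y : ∀ j, Y j, DifferentiableAt ℝ
            (DQNN.costAlong φin (fun x => DQNN.globalOp (φout x)) H (fun j => V j (y j))) 0) ∧
          DQNN.variance (fun y : ∀ j, Y j =>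
            DQNN.dCost φin (fun x => DQNN.globalOp (φout x)) H (fun j => V j (y j))) ≤ f n) ∧
        -- the local cost
        (∀ ψout : Fin N → Fin n → Fin 2 → ℂ, (∀ x j, DQNN.IsState (ψout x j)) →
          (∀ y : ∀ j, Y j, DifferentiableAt ℝ
            (DQNN.costAlong φin (fun x => DQNN.localOp (ψout x)) H (fun j => V j (y j))) 0) ∧
          DQNN.variance (fun y : ∀ j, Y j =>
            DQNN.dCost φin (fun x => DQNN.localOp (ψout x)) H (fun j => V j (y j))) ≤ f n) := by
  refine ⟨fun n => 48 * (1 / 2 ^ n), Asymptotics.isBigO_const_mul_self _ _ _, ?_⟩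
  intro n hn Y _ V hV H hH hH2 N hN φin hφ
  have hH2' : ∀ k, DQNN.fsq (H k) ≤ 2 ^ (n + 1) := fun k =>
    (DQNN.fsq_of_isHermitian (hH k)).trans_le (hH2 k)
  refine ⟨fun φout hφout => ?_, fun ψout hψout => ?_⟩
  · exact DQNN.variance_dCost_le hN φin
      (fun x => DQNN.one_sub_isHermitian (DQNN.proj_isHermitian (φout x))) H
      fun x => DQNN.expect_drift_globalOp_sq_le hn hV hH hH2' (hφ x) (hφout x)
  · exact DQNN.variance_dCost_le hN φin (fun x => DQNN.localOp_isHermitian (ψout x)) H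
      fun x => DQNN.expect_drift_localOp_sq_le hn hV hH hH2' (hφ x) (hψout x)
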